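/- Let $\mathbb{R}^n$ carry a norm $\|\cdot\|$ and let $C\subset\mathbb{R}^n$ be a cone of rank $k\ge 1$: $C$ is closed, $lv\in C$ for all $v\in C$ and $l\in\mathbb{R}$, and $k$ is the maximal dimension of a linear subspace contained in $C$. Assume that $C$ is $k$-solid, i.e. there is a $k$-dimensional subspace $W$ with $W\setminus\{0\}\subset \operatorname{Int}C$. Let $\Phi_t$, $t\in\mathbb{R}$, be a flow on $\mathbb{R}^n$ such that (a) for some $\alpha\in(0,1]$ the map $(t,x)\mapsto\Phi_t(x)$ is $C^1$ on $\mathbb{R}\times\mathbb{R}^n$ with locally $\alpha$-Hölder derivative; (b) $\Phi_t$ is strongly monotone with respect to $C$: if $x-y\in C$, then $\Phi_t(x)-\Phi_t(y)\in C$ for all $t\ge0$, and, if moreover $x\neq y$, then $\Phi_t(x)-\Phi_t(y)\in\operatorname{Int}C$ for all $t>0$; (c) $D_x\Phi_t(C\setminus\{0\})\subset\operatorname{Int}C$ for all $x\in\mathbb{R}^n$ and $t>0$. Write $O(x)=\{\Phi_t(x):t\ge0\}$ and $\omega(x)=\bigcap_{s\ge0}\overline{\{\Phi_t(x):t\ge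 s\}}$. A point $x$ is an equilibrium if $O(x)=\{x\}$. Let $Q$ be the set of points whose orbit is pseudo-ordered, i.e. the points $x$, not equilibria, for which there are $t_1,t_2\ge0$ with $\Phi_{t_1}(x)\ne\Phi_{t_2}(x)$ and $\Phi_{t_1}(x)-\Phi_{t_2}(x)\in C$. Let $K$ be a compact invariant set. A $k$-exponential separation along $K$ associated with $C$ is a pair of families $E=(E_y)_{y\in K}$, $F=(F_y)_{y\in K}$ of linear subspaces of dimensions $k$ and $n-k$, depending continuously on $y$ in the gap metric (the Hausdorff distance of unit spheres), such that for all $y\in K$: $\mathbb{R}^n=E_y\oplus F_y$; $D_y\Phi_tE_y=E_{\Phi_t(y)}$ and $D_y\Phi_tF_y\subset F_{\Phi_t(y)}$ for $t>0$; $E_y\subset\operatorname{Int}C\cup\{0\}$ and $F_y\cap C=\{0\}$; and, with constants $M>0$ and $0<\gamma<1$ independent of $y$, $\|D_y\Phi_tw\|\le M\gamma^t\|D_y\Phi_tv\|$ for all unit vectors $w\in F_y$, $v\in E_y$ and all $t\ge0$. Given such a separation, the $k$-Lyapunov exponent of $z\in K$ is $$\lambda_{kz}=\limsup_{t\to+\infty}\frac{\log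 m(D_z\Phi_t|_{E_z})}{t},\qquad m(D_z\Phi_t|_{E_z})=\inf_{v\in E_z,\ \|v\|=1}\|D_z\Phi_tv\|,$$ and $z$ is a regular point if this upper limit is a limit. **Theorem.** Let $x\in\mathbb{R}^n$ be a point whose orbit $O(x)$ is bounded. Then a $k$-exponential separation along $\omega(x)$ associated with $C$ exists. Moreover, for any such separation, if $z\in\omega(x)$ is a regular point with $\lambda_{kz}\le0$, then either $x\in Q$, or $\omega(x)=\{z\}$ and $z$ is an equilibrium. -/

import Mathlib

open Set Filter Topology
open scoped NNReal

namespace KCone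

section Cone

variable {V : Type*} [NormedAddCommGroup V] [NormedSpace ℝ V]

/-- A cone of rank `k`, `k ≥ 1`: a closed set, invariant under all real scalings, for which `k` is
the maximal dimension of a linear subspace that it contains. -/
structure IsKCone (k : ℕ) (C : Set V) : Prop where
  one_le : 1 ≤ k
  isClosed : IsClosed C
  smul_mem : ∀ v ∈ C, ∀ l : ℝ, l • v ∈ C
  rank : IsGreatest {d : ℕ | ∃ W : Submodule ℝ V, (W : Set V) ⊆ C ∧ Module.finrank ℝ W = d} k

/-- `C` is `k`-solid: some `k`-dimensional subspace `W` satisfies `W \ {0} ⊆ Int C`. -/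
def IsKSolid (k : ℕ) (C : Set V) : Prop :=
  ∃ W : Submodule ℝ V, Module.finrank ℝ W = k ∧ (W : Set V) \ {0} ⊆ interior C

/-- `x` and `y` are ordered. -/
def Ordered (C : Set V) (x y : V) : Prop := x - y ∈ C

/-- `x` and `y` are strongly ordered. -/
def StronglyOrdered (C : Set V) (x y : V) : Prop := x - y ∈ interior C

/-- The gap metric on subspaces: the Hausdorff distance of their unit spheres. -/
noncomputable def gapDist (L₁ L₂ : Submodule ℝ V) : ℝ :=
  Metric.hausdorffDist ((L₁ : Set V) ∩ Metric.sphere 0 1) ((L₂ : Set V) ∩ Metric.sphere 0 1)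

/-- `K × (Y x)` is a `d`-dimensional continuous vector bundle over `K`: the fibres over `K` are
`d`-dimensional, and depend continuously on the base point in the gap metric. -/
structure IsContinuousBundle (K : Set V) (d : ℕ) (Y : V → Submodule ℝ V) : Prop where
  finrank_eq : ∀ x ∈ K, Module.finrank ℝ (Y x) = d
  continuous : ∀ x ∈ K, Tendsto (fun y => gapDist (Y y) (Y x)) (𝓝[K] x) (𝓝 0)

/-- The infimum norm `inf {‖A v‖ : v ∈ L, ‖v‖ = 1}` of `A` restricted to `L`. -/
noncomputable def infNorm (A : V →L[ℝ] V) (L : Submodule ℝ V) : ℝ :=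
  sInf ((fun v => ‖A v‖) '' ((L : Set V) ∩ Metric.sphere 0 1))

end Cone

section Flow

variable {V : Type*} [NormedAddCommGroup V] [NormedSpace ℝ V]

/-- The derivative `D_x Φ_t` of the time-`t` map at `x`. -/
noncomputable def flowDeriv (Φ : Flow ℝ V) (t : ℝ) (x : V) : V →L[ℝ] V :=
  fderiv ℝ (Φ t) x

/-- `Φ` is `C^{1,α}`: the map `(t, x) ↦ Φ_t x` is `C^1` on `ℝ × V`, and its derivative is locally
`α`-Hölder continuous. -/
def IsC1Holder (α : ℝ≥0) (Φ : Flow ℝ V) : Prop :=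
  ContDiff ℝ 1 (fun p : ℝ × V => Φ p.1 p.2) ∧
    ∀ p : ℝ × V, ∃ U ∈ 𝓝 p, ∃ L : ℝ≥0,
      HolderOnWith L α (fderiv ℝ (fun q : ℝ × V => Φ q.1 q.2)) U

/-- `Φ` is monotone with respect to `C`. -/
def IsMonotone (C : Set V) (Φ : Flow ℝ V) : Prop :=
  ∀ x y : V, Ordered C x y → ∀ t : ℝ, 0 ≤ t → Ordered C (Φ t x) (Φ t y)

/-- `Φ` is strongly monotone with respect to `C`. -/
def IsStronglyMonotone (C : Set V) (Φ : Flow ℝ V) : Prop :=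
  IsMonotone C Φ ∧
    ∀ x y : V, x ≠ y → Ordered C x y → ∀ t : ℝ, 0 < t → StronglyOrdered C (Φ t x) (Φ t y)

/-- The standing assumptions on the flow: `C` is a `k`-solid cone of rank `k`, the flow is
`C^{1,α}` for some `α ∈ (0, 1]`, strongly monotone with respect to `C`, and
`D_x Φ_t (C \ {0}) ⊆ Int C` for all `x` and all `t > 0`. -/
structure FWW (k : ℕ) (C : Set V) (Φ : Flow ℝ V) : Prop where
  isKCone : IsKCone k C
  isKSolid : IsKSolid k C
  smooth : ∃ α : ℝ≥0, 0 < α ∧ α ≤ 1 ∧ IsC1Holder α Φ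
  stronglyMonotone : IsStronglyMonotone C Φ
  deriv_mapsTo : ∀ (t : ℝ) (x : V), 0 < t → MapsTo (flowDeriv Φ t x) (C \ {0}) (interior C)

/-- `x` is an equilibrium: its orbit `{Φ_t x : t ≥ 0}` is `{x}`. -/
def IsEquilibrium (Φ : Flow ℝ V) (x : V) : Prop := Φ.forwardOrbit x = {x}

/-- The set `Q` of points with a pseudo-ordered orbit: the orbit is nontrivial, and contains two
distinct points that are ordered. -/
def pseudoOrderedSet (C : Set V) (Φ : Flow ℝ V) : Set V :=
  {x | ¬ IsEquilibrium Φ x ∧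
    ∃ t₁ t₂ : ℝ, 0 ≤ t₁ ∧ 0 ≤ t₂ ∧ Φ t₁ x ≠ Φ t₂ x ∧ Ordered C (Φ t₁ x) (Φ t₂ x)}

/-- The omega-limit set of the point `x`. -/
def omegaSet (Φ : Flow ℝ V) (x : V) : Set V := omegaLimit atTop Φ {x}

/-- `E ⊕ F` is a `k`-exponential separation of `(Φ, DΦ)` along the compact invariant set `K`,
associated with `C`. -/
structure IsExpSeparation (k : ℕ) (C : Set V) (Φ : Flow ℝ V) (K : Set V)
    (E F : V → Submodule ℝ V) : Prop where
  bundle_E : IsContinuousBundle K k E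
  bundle_F : IsContinuousBundle K (Module.finrank ℝ V - k) F
  isCompl : ∀ x ∈ K, IsCompl (E x) (F x)
  map_E : ∀ x ∈ K, ∀ t : ℝ, 0 < t →
    (E x).map (flowDeriv Φ t x : V →ₗ[ℝ] V) = E (Φ t x)
  map_F : ∀ x ∈ K, ∀ t : ℝ, 0 < t →
    (F x).map (flowDeriv Φ t x : V →ₗ[ℝ] V) ≤ F (Φ t x)
  separation : ∃ M γ : ℝ, 0 < M ∧ 0 < γ ∧ γ < 1 ∧
    ∀ x ∈ K, ∀ w ∈ F x, ‖w‖ = 1 → ∀ v ∈ E x, ‖v‖ = 1 → ∀ t : ℝ, 0 ≤ t →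
      ‖flowDeriv Φ t x w‖ ≤ M * γ ^ t * ‖flowDeriv Φ t x v‖
  E_subset : ∀ x ∈ K, (E x : Set V) ⊆ interior C ∪ {0}
  F_inter : ∀ x ∈ K, (F x : Set V) ∩ C = {0}

/-- The quotient `log m(D_x Φ_t | E_x) / t`, as an extended real. -/
noncomputable def lyapunovQuotient (Φ : Flow ℝ V) (E : V → Submodule ℝ V) (x : V) (t : ℝ) :
    EReal :=
  ((Real.log (infNorm (flowDeriv Φ t x) (E x)) / t : ℝ) : EReal)

/-- The `k`-Lyapunov exponent of `x` (with respect to the `k`-dimensional bundle `E`), as an upper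
limit of extended reals. -/
noncomputable def lyapunovExponent (Φ : Flow ℝ V) (E : V → Submodule ℝ V) (x : V) : EReal :=
  limsup (lyapunovQuotient Φ E x) atTop

/-- `x` is a regular point: the upper limit that defines its `k`-Lyapunov exponent is a limit. -/
def IsRegularPoint (Φ : Flow ℝ V) (E : V → Submodule ℝ V) (x : V) : Prop :=
  Tendsto (lyapunovQuotient Φ E x) atTop (𝓝 (lyapunovExponent Φ E x))

end Flow

end KCone

/-! Existence of the separation. By compactness the time-one derivative pushes `C` into its interior
with a uniform relative margin, and the time minus one derivative pushes the complementary cone off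
`C` in the same way. Because of these margins (`add_mem_of_orbit_mem`), the vectors whose linearised
orbit stays in `C` for all real times form a subspace `E y`, and those whose forward orbit stays in
the complementary cone form a subspace `F y`. Solidity gives `E y` dimension at least `k`;
maximality of `k` gives the other inequality and makes every subspace properly containing `E y` meet
`F y` nontrivially, so the two are complementary. Both are cut out by closed conditions, hence
continuous, and the margin yields the geometric rate of domination.

The alternative. Let `m n` be the infimum norm of the time-`n` derivative on `E z`. A nonpositive
exponent makes `g n = γ ^ n * m n` exponentially small, and the separation bounds the derivative on
`F` from time `j` to `j + i` by a constant times `g (j + i) / g j`. If the orbit of a nearby `y` is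
never ordered with that of `z`, the difference of the orbits stays outside `C`, so its `F`-component
controls it. The Hölder remainder is summable relative to `g`, and a bootstrap shows that the
difference decays like `g` (`exists_local_alternative`).

Suppose now that `x` is neither in `Q` nor an equilibrium. Strong monotonicity prevents any `Φ τ x ≠
z` from becoming ordered with `z`. Hence for all `τ ≥ 0` with `Φ τ x` close to `z`, in particular
for an open set of times, `Φ (t + τ) x` is asymptotic to `Φ t z`. Comparing two such `τ` shows that
`z` is fixed by `Φ s` for all small `s ≥ 0`; so `z` is an equilibrium and the orbit of `x` converges
to it. -/

namespace KCone

/-! ### Cone margins, invariant subspaces and continuity of bundles. -/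

section Abstract

variable {V : Type*} [NormedAddCommGroup V] [NormedSpace ℝ V]

/-- A continuous family of operators over a compact set that maps a closed cone, apart from the
origin, into an open cone does so with a uniform relative margin. -/
theorem exists_uniform_margin [FiniteDimensional ℝ V] {K P O : Set V} (T : V → V →L[ℝ] V)
    (hT : Continuous T)
    (hK : IsCompact K) (hP : IsClosed P) (hO : IsOpen O)
    (hPs : ∀ v ∈ P, ∀ l : ℝ, l • v ∈ P) (hOs : ∀ v ∈ O, ∀ l : ℝ, l ≠ 0 → l • v ∈ O)
    (hTPO : ∀ y ∈ K, ∀ u ∈ P, u ≠ 0 → T y u ∈ O) :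
    ∃ ε : ℝ, 0 < ε ∧ ∀ y ∈ K, ∀ u ∈ P, u ≠ 0 → ∀ w, ‖w - T y u‖ ≤ ε * ‖T y u‖ → w ∈ O := by
  -- By homogeneity only unit vectors matter, and their images form a compact subset of `O`.
  have hc : IsCompact (K ×ˢ (P ∩ Metric.sphere (0 : V) 1)) :=
    hK.prod ((isCompact_sphere 0 1).inter_left hP)
  have hf : Continuous fun p : V × V => T p.1 p.2 := by fun_prop
  have hS := hc.image hf
  obtain ⟨δ, hδ, hsub⟩ := hS.exists_cthickening_subset_open hO (by
    rintro _ ⟨⟨y, u⟩, ⟨hy, hu, hu1⟩, rfl⟩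
    refine hTPO y hy u hu ?_
    rintro rfl
    simp at hu1)
  obtain ⟨B, hB⟩ := hS.isBounded.exists_norm_le
  refine ⟨δ / (|B| + 1), by positivity, fun y hy u hu hu0 w hw => ?_⟩
  have hn : 0 < ‖u‖ := norm_pos_iff.2 hu0
  set u' := ‖u‖⁻¹ • u with hu'
  have hmem : T y u' ∈ (fun p : V × V => T p.1 p.2) '' (K ×ˢ (P ∩ Metric.sphere (0 : V) 1)) :=
    ⟨(y, u'), ⟨hy, hPs _ hu _, by simp [hu', norm_smul, hn.ne']⟩, rfl⟩
  have hw' : ‖u‖⁻¹ • w ∈ O := by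
    refine hsub (Metric.mem_cthickening_of_dist_le _ (T y u') _ _ hmem ?_)
    have h1 : ‖u‖⁻¹ • w - T y u' = ‖u‖⁻¹ • (w - T y u) := by simp [hu', smul_sub]
    have h2 : ‖T y u'‖ = ‖u‖⁻¹ * ‖T y u‖ := by simp [hu', norm_smul]
    have h3 : ‖T y u'‖ ≤ |B| := (hB _ hmem).trans (le_abs_self B)
    rw [dist_eq_norm, h1, norm_smul, norm_inv, norm_norm]
    calc ‖u‖⁻¹ * ‖w - T y u‖ ≤ ‖u‖⁻¹ * (δ / (|B| + 1) * ‖T y u‖) := by gcongr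
      _ = δ / (|B| + 1) * ‖T y u'‖ := by rw [h2]; ring
      _ ≤ δ / (|B| + 1) * (|B| + 1) := by gcongr; linarith
      _ = δ := by field_simp
  have := hOs _ hw' ‖u‖ hn.ne'
  rwa [smul_smul, mul_inv_cancel₀ hn.ne', one_smul] at this

/-- The vectors whose whole (backward) orbit stays in a cone form an additively closed set, if the
cone is mapped into itself with a uniform relative margin. -/
theorem add_mem_of_orbit_mem {P : Set V} (hP : IsClosed P) (hPs : ∀ v ∈ P, ∀ l : ℝ, l • v ∈ P)
    (B : ℕ → V →L[ℝ] V) {ε : ℝ} (hε : 0 < ε)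
    (hB : ∀ n u w, B (n + 1) u ∈ P → ‖w - B n u‖ ≤ ε * ‖B n u‖ → w ∈ P)
    {e v : V} (he : ∀ n, B n e ∈ P) (hv : ∀ n, B n v ∈ P) (m : ℕ) : B m (e + v) ∈ P := by
  have mono : ∀ (u : V) (N n : ℕ), N ≤ n → B n u ∈ P → B N u ∈ P := by
    intro u N n h
    induction n, h using Nat.le_induction with
    | base => exact id
    | succ n h ih => exact fun hu => ih (hB n u _ hu (by simp; positivity))
  -- Connectedness of the line `e + r • v`: the good parameters are clopen and contain `0`, hence
  -- contain `1`.
  let R : Set ℝ := {r | ∀ n, B n (e + r • v) ∈ P}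
  have hclosed : IsClosed R := by
    simp only [R, ofPred_forall]
    exact isClosed_iInter fun n => hP.preimage (by fun_prop)
  have hopen : IsOpen R := by
    rw [Metric.isOpen_iff]
    intro r hr
    set u := e + r • v with hu
    have key : ∀ s : ℝ, e + (r + s) • v = u + s • v := fun s => by rw [hu, add_smul, add_assoc]
    -- Either the orbit of `u` eventually dominates a multiple of that of `v`, and a small multiple
    -- of `v` stays within the margin of `u`; or at arbitrarily late times `u` is negligible against
    -- `s • v`, and the sum lies within the margin of `s • v`, whatever `s ≠ 0` is.
    by_cases hcase : ∃ c : ℝ, 0 < c ∧ ∃ N, ∀ n, N ≤ n → c * ‖B n v‖ ≤ ‖B n u‖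
    · obtain ⟨c, hc, N, hN⟩ := hcase
      refine ⟨ε * c, by positivity, fun r' hr' n => ?_⟩
      obtain ⟨s, rfl⟩ : ∃ s, r' = r + s := ⟨r' - r, by ring⟩
      have hs : |s| < ε * c := by simpa [Real.dist_eq] using hr'
      refine mono _ n (max n N) (le_max_left _ _) ?_
      rw [key]
      refine hB (max n N) u _ (hr _) ?_
      have := hN (max n N) (le_max_right _ _)
      have h1 : B (max n N) (u + s • v) - B (max n N) u = s • B (max n N) v := by simp
      rw [h1, norm_smul, Real.norm_eq_abs]
      calc |s| * ‖B (max n N) v‖ ≤ ε * c * ‖B (max n N) v‖ := by gcongr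
        _ = ε * (c * ‖B (max n N) v‖) := by ring
        _ ≤ _ := by gcongr
    · push Not at hcase
      refine ⟨1, one_pos, fun r' _ n => ?_⟩
      obtain ⟨s, rfl⟩ : ∃ s, r' = r + s := ⟨r' - r, by ring⟩
      rcases eq_or_ne s 0 with rfl | hs
      · rw [add_zero]; exact hr n
      obtain ⟨m, hm, hlt⟩ := hcase (ε * |s|) (by positivity) n
      refine mono _ n m hm ?_
      rw [key]
      refine hB m (s • v) _ (by rw [map_smul]; exact hPs _ (hv _) _) ?_
      have h1 : B m (u + s • v) - B m (s • v) = B m u := by simp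
      rw [h1, map_smul, norm_smul, Real.norm_eq_abs, ← mul_assoc]
      exact hlt.le
  have huniv : R = univ :=
    IsClopen.eq_univ ⟨hclosed, hopen⟩ ⟨0, fun n => by simpa using he n⟩
  have h1 : (1 : ℝ) ∈ R := huniv ▸ mem_univ _
  simpa using h1 m

/-- If every member of a decreasing sequence of closed sets contains a `k`-dimensional subspace, and
their intersection is a subspace, then its dimension is at least `k`. -/
theorem le_finrank_of_decreasing [FiniteDimensional ℝ V] {k : ℕ} (S : ℕ → Set V)
    (hS : ∀ n, IsClosed (S n)) (hmono : ∀ n, S (n + 1) ⊆ S n)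
    (hW : ∀ n, ∃ W : Submodule ℝ V, Module.finrank ℝ W = k ∧ (W : Set V) ⊆ S n)
    (L : Submodule ℝ V) (hL : ∀ v, (∀ n, v ∈ S n) → v ∈ L) : k ≤ Module.finrank ℝ L := by
  let φ := toEuclidean (E := V)
  -- Orthonormal `k`-frames with all vectors in `S n` form nested nonempty compact sets; a common
  -- frame stays independent because orthonormality is a closed condition.
  let X : ℕ → Set (Fin k → EuclideanSpace ℝ (Fin (Module.finrank ℝ V))) := fun n =>
    {f | Orthonormal ℝ f ∧ ∀ i, φ.symm (f i) ∈ S n}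
  have hcl0 : IsClosed {f : Fin k → EuclideanSpace ℝ (Fin (Module.finrank ℝ V)) |
      Orthonormal ℝ f} := by
    simp only [orthonormal_iff_ite, ofPred_forall]
    refine isClosed_iInter fun i => isClosed_iInter fun j => isClosed_eq ?_ continuous_const
    fun_prop
  have hcl : ∀ n, IsClosed (X n) := fun n => by
    have : IsClosed (⋂ i : Fin k, {f : Fin k → EuclideanSpace ℝ (Fin (Module.finrank ℝ V)) |
        φ.symm (f i) ∈ S n}) :=
      isClosed_iInter fun i => (hS n).preimage (φ.symm.continuous.comp (continuous_apply i))
    convert hcl0.inter this using 1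
    ext f
    simp [X]
  have hne : ∀ n, (X n).Nonempty := fun n => by
    obtain ⟨W, hWk, hWS⟩ := hW n
    let W' := W.map (φ : V →ₗ[ℝ] EuclideanSpace ℝ (Fin (Module.finrank ℝ V)))
    have hW' : Module.finrank ℝ W' = k := by
      rw [← hWk]
      exact LinearEquiv.finrank_map_eq φ.toLinearEquiv W
    let b := (stdOrthonormalBasis ℝ W').reindex (finCongr hW')
    refine ⟨fun i => (b i : EuclideanSpace ℝ (Fin (Module.finrank ℝ V))), ?_, fun i => ?_⟩
    · exact b.orthonormal.comp_linearIsometry W'.subtypeₗᵢ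
    · obtain ⟨w, hw, hwi⟩ := (b i).2
      have : φ w = (b i : EuclideanSpace ℝ (Fin (Module.finrank ℝ V))) := hwi
      beta_reduce
      rw [← this, φ.symm_apply_apply]
      exact hWS hw
  have hcomp : IsCompact (X 0) := by
    refine Metric.isCompact_of_isClosed_isBounded (hcl 0) ?_
    refine (Metric.isBounded_closedBall (x := 0) (r := 1)).subset fun f hf => ?_
    rw [mem_closedBall_zero_iff, pi_norm_le_iff_of_nonneg zero_le_one]
    exact fun i => (hf.1.1 i).le
  obtain ⟨f, hf⟩ := IsCompact.nonempty_iInter_of_sequence_nonempty_isCompact_isClosed X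
    (fun n f hf => ⟨hf.1, fun i => hmono n (hf.2 i)⟩) hne hcomp hcl
  rw [mem_iInter] at hf
  let g : Fin k → L := fun i => ⟨φ.symm (f i), hL _ fun n => (hf n).2 i⟩
  have hg : LinearIndependent ℝ g := by
    have h1 := (hf 0).1.linearIndependent.map' (φ.symm.toLinearEquiv : _ →ₗ[ℝ] V)
      (LinearEquiv.ker _)
    exact LinearIndependent.of_comp L.subtype h1
  simpa using hg.fintype_card_le_finrank

/-- A family of subspaces of constant dimension with closed graph is continuous in the gap
metric. -/
theorem isContinuousBundle_of_isClosed [FiniteDimensional ℝ V] {K : Set V} {d : ℕ}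
    {Y : V → Submodule ℝ V} (hd : ∀ x ∈ K, Module.finrank ℝ (Y x) = d) {Γ : Set (V × V)}
    (hΓ : IsClosed Γ) (hY : ∀ x ∈ K, ∀ v, v ∈ Y x ↔ (x, v) ∈ Γ) : IsContinuousBundle K d Y := by
  refine ⟨hd, fun x hx => ?_⟩
  obtain ⟨p₀, hp₀⟩ := LinearMap.exists_leftInverse_of_injective (Y x).subtype (Submodule.ker_subtype _)
  let p : V →L[ℝ] V := LinearMap.toContinuousLinearMap ((Y x).subtype ∘ₗ p₀)
  have hpl : ∀ l ∈ Y x, p l = l := fun l hl => by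
    have := LinearMap.congr_fun hp₀ ⟨l, hl⟩
    simp only [LinearMap.comp_apply, Submodule.subtype_apply, LinearMap.id_apply] at this
    simp [p, this]
  have hpr : ∀ v, p v ∈ Y x := fun v => by simp [p]
  -- A closed graph and compactness of the sphere give upper semicontinuity; equality of dimensions
  -- gives the other half, since the projection `p` is then a bijection of nearby fibres onto `Y x`.
  have upper : ∀ δ : ℝ, 0 < δ → ∀ᶠ y in 𝓝[K] x, ∀ w ∈ (Y y : Set V) ∩ Metric.sphere 0 1,
      ∃ l ∈ (Y x : Set V) ∩ Metric.sphere 0 1, dist w l < δ := by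
    intro δ hδ
    have hD : IsCompact (Metric.sphere (0 : V) 1 \
        Metric.thickening δ ((Y x : Set V) ∩ Metric.sphere 0 1)) :=
      (isCompact_sphere 0 1).diff Metric.isOpen_thickening
    have := hD.eventually_forall_of_forall_eventually (x₀ := x) (P := fun y w => (y, w) ∉ Γ)
      fun w hw => by
        refine hΓ.isOpen_compl.mem_nhds fun hmem => hw.2 ?_
        exact Metric.self_subset_thickening hδ _ ⟨(hY x hx w).2 hmem, hw.1⟩
    filter_upwards [this.filter_mono nhdsWithin_le_nhds, self_mem_nhdsWithin] with y hy hyK w hw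
    by_contra hcon
    refine hy w ⟨hw.2, fun hth => hcon ?_⟩ ((hY y hyK w).1 hw.1)
    exact Metric.mem_thickening_iff.1 hth
  rw [Metric.tendsto_nhds]
  intro ε hε
  -- `δ' ≤ 1 / 2` makes `p` injective on `Y y` and preimages of unit vectors of norm at most `2`;
  -- the distance `2 * δ'` to such a preimage doubles on normalising it.
  obtain ⟨δ', hδ'0, hδ'1, hδ'2⟩ : ∃ δ' : ℝ, 0 < δ' ∧ δ' ≤ 1 / 2 ∧ 4 * δ' < ε :=
    ⟨min (1 / 2) (ε / 8), by positivity, min_le_left _ _, by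
      linarith [min_le_right (1 / 2 : ℝ) (ε / 8)]⟩
  have hδ : 0 < δ' / (1 + ‖p‖) := by positivity
  have hδle : δ' / (1 + ‖p‖) ≤ δ' := div_le_self hδ'0.le (by linarith [norm_nonneg p])
  filter_upwards [upper _ hδ, self_mem_nhdsWithin] with y hy hyK
  have hclose : ∀ w ∈ Y y, ‖w - p w‖ ≤ δ' * ‖w‖ := by
    intro w hw
    rcases eq_or_ne w 0 with rfl | hw0
    · simp
    have hn : 0 < ‖w‖ := norm_pos_iff.2 hw0
    obtain ⟨l, hl, hwl⟩ := hy (‖w‖⁻¹ • w) ⟨(Y y).smul_mem _ hw, by simp [norm_smul, hn.ne']⟩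
    set w' := ‖w‖⁻¹ • w with hw'
    have h1 : w' - p w' = (w' - l) - p (w' - l) := by rw [map_sub, hpl l hl.1]; abel
    have h2 : ‖w' - p w'‖ ≤ δ' := by
      rw [h1]
      rw [dist_eq_norm] at hwl
      calc _ ≤ ‖w' - l‖ + ‖p‖ * ‖w' - l‖ :=
            (norm_sub_le _ _).trans (add_le_add le_rfl (p.le_opNorm _))
        _ = (1 + ‖p‖) * ‖w' - l‖ := by ring
        _ ≤ (1 + ‖p‖) * (δ' / (1 + ‖p‖)) := by gcongr
        _ = δ' := by field_simp
    have h3 : w - p w = ‖w‖ • (w' - p w') := by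
      rw [hw', map_smul, ← smul_sub, smul_smul, mul_inv_cancel₀ hn.ne', one_smul]
    rw [h3, norm_smul, norm_norm, mul_comm]
    gcongr
  have hsurj : ∀ l ∈ Y x, ∃ w ∈ Y y, p w = l := by
    let q : Y y →ₗ[ℝ] Y x := (p : V →ₗ[ℝ] V).restrict (p := Y y) (q := Y x) fun w _ => hpr w
    have hinj : Function.Injective q := by
      rw [← LinearMap.ker_eq_bot, LinearMap.ker_eq_bot']
      intro w hw
      have h0 : p w = 0 := congrArg Subtype.val hw
      have := hclose w w.2
      rw [h0, sub_zero] at this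
      have : ‖(w : V)‖ = 0 := by nlinarith [norm_nonneg (w : V)]
      exact Subtype.ext (norm_eq_zero.1 this)
    have hs := (LinearMap.injective_iff_surjective_of_finrank_eq_finrank
      ((hd y hyK).trans (hd x hx).symm)).1 hinj
    intro l hl
    obtain ⟨w, hw⟩ := hs ⟨l, hl⟩
    exact ⟨w, w.2, congrArg Subtype.val hw⟩
  rw [Real.dist_0_eq_abs, abs_of_nonneg (by exact Metric.hausdorffDist_nonneg)]
  refine lt_of_le_of_lt (Metric.hausdorffDist_le_of_mem_dist (r := 4 * δ') (by positivity) ?_ ?_) hδ'2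
  · intro w hw
    obtain ⟨l, hl, hwl⟩ := hy w hw
    exact ⟨l, hl, by linarith⟩
  · rintro l ⟨hl, hl1⟩
    rw [mem_sphere_zero_iff_norm] at hl1
    obtain ⟨w, hw, hwl⟩ := hsurj l hl
    have h1 := hclose w hw
    rw [hwl] at h1
    have h2 : |‖w‖ - ‖l‖| ≤ ‖w - l‖ := abs_norm_sub_norm_le w l
    rw [hl1, abs_le] at h2
    have h3 : ‖w‖ ≤ 2 := by nlinarith [norm_nonneg w]
    have h4 : ‖w - l‖ ≤ 2 * δ' := by nlinarith
    have hn : 0 < ‖w‖ := by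
      rw [norm_pos_iff]; rintro rfl
      simp at hwl; simp [← hwl] at hl1
    refine ⟨‖w‖⁻¹ • w, ⟨(Y y).smul_mem _ hw, by simp [norm_smul, hn.ne']⟩, ?_⟩
    have h5 : ‖w - ‖w‖⁻¹ • w‖ = |‖w‖ - 1| := by
      have : w - ‖w‖⁻¹ • w = ((‖w‖ - 1) * ‖w‖⁻¹) • w := by
        rw [sub_mul, mul_inv_cancel₀ hn.ne', sub_smul, one_smul, one_mul]
      rw [this, norm_smul, norm_mul, norm_inv, norm_norm, mul_assoc, inv_mul_cancel₀ hn.ne', mul_one,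
        Real.norm_eq_abs]
    rw [dist_comm, dist_eq_norm]
    have h6 : |‖w‖ - 1| ≤ ‖w - l‖ := abs_le.2 h2
    calc ‖‖w‖⁻¹ • w - l‖ = ‖(w - l) - (w - ‖w‖⁻¹ • w)‖ := by congr 1; abel
      _ ≤ ‖w - l‖ + ‖w - ‖w‖⁻¹ • w‖ := norm_sub_le _ _
      _ ≤ 4 * δ' := by rw [h5]; linarith

end Abstract

/-! ### The linearised flow as an invertible cocycle. -/

section FlowDeriv

theorem flow_neg_flow {X : Type*} [TopologicalSpace X] (Φ : Flow ℝ X) (t : ℝ) (y : X) : Φ (-t) (Φ t y) = y := by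
  rw [← Φ.map_add, neg_add_cancel, Φ.map_zero_apply]

theorem flow_flow_neg {X : Type*} [TopologicalSpace X] (Φ : Flow ℝ X) (t : ℝ) (y : X) : Φ t (Φ (-t) y) = y := by
  rw [← Φ.map_add, add_neg_cancel, Φ.map_zero_apply]

variable {V : Type*} [NormedAddCommGroup V] [NormedSpace ℝ V] {Φ : Flow ℝ V}

theorem hasFDerivAt_flow (h : ContDiff ℝ 1 (fun p : ℝ × V => Φ p.1 p.2)) (t : ℝ) (y : V) :
    HasFDerivAt (Φ t) ((fderiv ℝ (fun p : ℝ × V => Φ p.1 p.2) (t, y)).comp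
      (ContinuousLinearMap.inr ℝ ℝ V)) y := by
  have h1 : HasFDerivAt (fun p : ℝ × V => Φ p.1 p.2) _ (t, y) :=
    ((h.differentiable one_ne_zero) (t, y)).hasFDerivAt
  exact h1.comp y (hasFDerivAt_prodMk_right t y)

theorem flowDeriv_eq (h : ContDiff ℝ 1 (fun p : ℝ × V => Φ p.1 p.2)) (t : ℝ) (y : V) :
    flowDeriv Φ t y = (fderiv ℝ (fun p : ℝ × V => Φ p.1 p.2) (t, y)).comp
      (ContinuousLinearMap.inr ℝ ℝ V) :=
  (hasFDerivAt_flow h t y).fderiv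

theorem hasFDerivAt_flowDeriv (h : ContDiff ℝ 1 (fun p : ℝ × V => Φ p.1 p.2)) (t : ℝ) (y : V) :
    HasFDerivAt (Φ t) (flowDeriv Φ t y) y :=
  (hasFDerivAt_flow h t y).differentiableAt.hasFDerivAt

theorem continuous_flowDeriv (h : ContDiff ℝ 1 (fun p : ℝ × V => Φ p.1 p.2)) :
    Continuous fun p : ℝ × V => flowDeriv Φ p.1 p.2 := by
  simp only [flowDeriv_eq h]
  have := h.continuous_fderiv one_ne_zero
  exact (this.comp (continuous_id)).clm_comp continuous_const

theorem flowDeriv_add (h : ContDiff ℝ 1 (fun p : ℝ × V => Φ p.1 p.2)) (s t : ℝ) (y v : V) :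
    flowDeriv Φ (s + t) y v = flowDeriv Φ s (Φ t y) (flowDeriv Φ t y v) := by
  have h1 : HasFDerivAt (Φ (s + t)) ((flowDeriv Φ s (Φ t y)).comp (flowDeriv Φ t y)) y := by
    have : Φ (s + t) = Φ s ∘ Φ t := funext fun x => Φ.map_add s t x
    rw [this]
    exact (hasFDerivAt_flowDeriv h s (Φ t y)).comp y (hasFDerivAt_flowDeriv h t y)
  rw [show flowDeriv Φ (s + t) y = _ from h1.fderiv]
  rfl

theorem flowDeriv_zero (y v : V) : flowDeriv Φ 0 y v = v := by
  rw [flowDeriv, Φ.map_zero, fderiv_id]; rfl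

theorem flowDeriv_neg_flowDeriv (h : ContDiff ℝ 1 (fun p : ℝ × V => Φ p.1 p.2)) (t : ℝ) (y v : V) :
    flowDeriv Φ (-t) (Φ t y) (flowDeriv Φ t y v) = v := by
  rw [← flowDeriv_add h, neg_add_cancel, flowDeriv_zero]

theorem flowDeriv_flowDeriv_neg (h : ContDiff ℝ 1 (fun p : ℝ × V => Φ p.1 p.2)) (t : ℝ) (y v : V) :
    flowDeriv Φ t (Φ (-t) y) (flowDeriv Φ (-t) y v) = v := by
  rw [← flowDeriv_add h, add_neg_cancel, flowDeriv_zero]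

theorem flowDeriv_injective (h : ContDiff ℝ 1 (fun p : ℝ × V => Φ p.1 p.2)) (t : ℝ) (y : V) :
    Function.Injective (flowDeriv Φ t y) :=
  Function.LeftInverse.injective (flowDeriv_neg_flowDeriv h t y)

theorem flowDeriv_ne_zero (h : ContDiff ℝ 1 (fun p : ℝ × V => Φ p.1 p.2)) (t : ℝ) (y : V) {v : V}
    (hv : v ≠ 0) : flowDeriv Φ t y v ≠ 0 := by
  rwa [Ne, map_eq_zero_iff _ (flowDeriv_injective h t y)]

theorem finrank_map_of_injective {T : V →L[ℝ] V} (hT : Function.Injective T) (W : Submodule ℝ V) :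
    Module.finrank ℝ (W.map (T : V →ₗ[ℝ] V)) = Module.finrank ℝ W :=
  (Submodule.equivMapOfInjective (T : V →ₗ[ℝ] V) hT W).finrank_eq.symm

/-- Lower bound for the unit-time derivatives along a compact set. -/
theorem exists_le_norm_flowDeriv (h : ContDiff ℝ 1 (fun p : ℝ × V => Φ p.1 p.2)) {K : Set V}
    (hK : IsCompact K) :
    ∃ c : ℝ, 0 < c ∧ ∀ y ∈ K, ∀ v, c * ‖v‖ ≤ ‖flowDeriv Φ 1 y v‖ := by
  have hf : Continuous fun y : V => flowDeriv Φ (-1) (Φ 1 y) :=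
    (continuous_flowDeriv h).comp (continuous_const.prodMk (Φ.continuous_toFun 1))
  obtain ⟨B, hB⟩ := (hK.image hf).isBounded.exists_norm_le
  refine ⟨(|B| + 1)⁻¹, by positivity, fun y hy v => ?_⟩
  have h1 : ‖v‖ ≤ (|B| + 1) * ‖flowDeriv Φ 1 y v‖ := by
    calc ‖v‖ = ‖flowDeriv Φ (-1) (Φ 1 y) (flowDeriv Φ 1 y v)‖ := by
          rw [flowDeriv_neg_flowDeriv h]
      _ ≤ ‖flowDeriv Φ (-1) (Φ 1 y)‖ * ‖flowDeriv Φ 1 y v‖ := ContinuousLinearMap.le_opNorm _ _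
      _ ≤ _ := by
        gcongr
        exact (hB _ ⟨y, hy, rfl⟩).trans ((le_abs_self B).trans (by linarith))
  rw [inv_mul_le_iff₀ (by positivity)]
  exact h1

end FlowDeriv

/-! ### The cone and its complementary cone. -/

section Cone

/-- The complementary cone. -/
def coCone {V : Type*} [NormedAddCommGroup V] (C : Set V) : Set V := (interior C)ᶜ ∪ {0}

theorem isClosed_coCone {V : Type*} [NormedAddCommGroup V] {C : Set V} : IsClosed (coCone C) :=
  isOpen_interior.isClosed_compl.union isClosed_singleton

theorem mem_coCone {V : Type*} [NormedAddCommGroup V] {C : Set V} {v : V} : v ∈ coCone C ↔ v ∈ interior C → v = 0 := by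
  by_cases h : v ∈ interior C <;> simp [coCone, h]

variable {V : Type*} [NormedAddCommGroup V] [NormedSpace ℝ V] {k : ℕ} {C : Set V}

theorem IsKCone.zero_mem (hC : IsKCone k C) : (0 : V) ∈ C := by
  obtain ⟨W, hW, -⟩ := hC.rank.1
  exact hW W.zero_mem

open scoped Pointwise in
theorem IsKCone.smul_mem_interior (hC : IsKCone k C) {v : V} (hv : v ∈ interior C) {l : ℝ}
    (hl : l ≠ 0) : l • v ∈ interior C := by
  have h1 : l • interior C = interior (l • C) := (interior_smul₀ hl C).symm
  have h2 : l • C ⊆ C := by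
    rintro _ ⟨w, hw, rfl⟩
    exact hC.smul_mem w hw l
  exact interior_mono h2 (h1 ▸ smul_mem_smul_set hv)

theorem IsKCone.smul_mem_coCone (hC : IsKCone k C) {v : V} (hv : v ∈ coCone C) (l : ℝ) :
    l • v ∈ coCone C := by
  rw [mem_coCone] at *
  intro h
  rcases eq_or_ne l 0 with rfl | hl
  · simp
  have := hC.smul_mem_interior h (inv_ne_zero hl)
  rw [smul_smul, inv_mul_cancel₀ hl, one_smul] at this
  rw [hv this, smul_zero]

theorem IsKCone.compl_smul_mem (hC : IsKCone k C) {v : V} (hv : v ∈ Cᶜ) {l : ℝ} (hl : l ≠ 0) :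
    l • v ∈ Cᶜ := by
  intro h
  have := hC.smul_mem _ h l⁻¹
  rw [smul_smul, inv_mul_cancel₀ hl, one_smul] at this
  exact hv this

end Cone

/-! ### Invariant cone fields and the subspaces they define. -/

section Invariance

variable {V : Type*} [NormedAddCommGroup V] [NormedSpace ℝ V] {k : ℕ} {C : Set V} {Φ : Flow ℝ V}

theorem FWW.contDiff (hΦ : FWW k C Φ) : ContDiff ℝ 1 (fun p : ℝ × V => Φ p.1 p.2) := by
  obtain ⟨α, -, -, h⟩ := hΦ.smooth
  exact h.1

theorem FWW.deriv_mem_interior (hΦ : FWW k C Φ) {t : ℝ} (ht : 0 < t) (y : V) {v : V} (hv : v ∈ C)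
    (h0 : v ≠ 0) : flowDeriv Φ t y v ∈ interior C :=
  hΦ.deriv_mapsTo t y ht ⟨hv, h0⟩

theorem FWW.deriv_mem_of_le (hΦ : FWW k C Φ) {s t : ℝ} (hst : s ≤ t) {y v : V}
    (hv : flowDeriv Φ s y v ∈ C) : flowDeriv Φ t y v ∈ C := by
  rcases hst.eq_or_lt with rfl | hlt
  · exact hv
  rcases eq_or_ne v 0 with rfl | h0
  · simpa using hv
  have : flowDeriv Φ (t - s) (Φ s y) (flowDeriv Φ s y v) ∈ interior C :=
    hΦ.deriv_mem_interior (sub_pos.2 hlt) _ hv (flowDeriv_ne_zero hΦ.contDiff _ _ h0)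
  rw [← flowDeriv_add hΦ.contDiff, sub_add_cancel] at this
  exact interior_subset this

theorem FWW.deriv_mem_interior_of_lt (hΦ : FWW k C Φ) {s t : ℝ} (hst : s < t) {y v : V}
    (h0 : v ≠ 0) (hv : flowDeriv Φ s y v ∈ C) : flowDeriv Φ t y v ∈ interior C := by
  have : flowDeriv Φ (t - s) (Φ s y) (flowDeriv Φ s y v) ∈ interior C :=
    hΦ.deriv_mem_interior (sub_pos.2 hst) _ hv (flowDeriv_ne_zero hΦ.contDiff _ _ h0)
  rwa [← flowDeriv_add hΦ.contDiff, sub_add_cancel] at this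

theorem FWW.mem_coCone_of_le (hΦ : FWW k C Φ) {s t : ℝ} (hst : s ≤ t) {y v : V}
    (hv : flowDeriv Φ t y v ∈ coCone C) : flowDeriv Φ s y v ∈ coCone C := by
  rcases hst.eq_or_lt with rfl | hlt
  · exact hv
  rw [mem_coCone] at *
  intro h
  by_contra h0
  have hv0 : v ≠ 0 := by rintro rfl; simp at h0
  exact flowDeriv_ne_zero hΦ.contDiff t y hv0
    (hv (hΦ.deriv_mem_interior_of_lt hlt hv0 (interior_subset h)))

variable [FiniteDimensional ℝ V] {K : Set V}

theorem FWW.exists_margin (hΦ : FWW k C Φ) (hK : IsCompact K) :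
    ∃ ε : ℝ, 0 < ε ∧ ∀ y ∈ K, ∀ u ∈ C, u ≠ 0 → ∀ w,
      ‖w - flowDeriv Φ 1 y u‖ ≤ ε * ‖flowDeriv Φ 1 y u‖ → w ∈ interior C :=
  exists_uniform_margin (flowDeriv Φ 1)
    ((continuous_flowDeriv hΦ.contDiff).comp (continuous_const.prodMk continuous_id)) hK
    hΦ.isKCone.isClosed isOpen_interior hΦ.isKCone.smul_mem
    (fun _ hv _ hl => hΦ.isKCone.smul_mem_interior hv hl)
    fun y _ _ hu h0 => hΦ.deriv_mem_interior one_pos y hu h0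

/-- Time reversal exchanges the roles of the two cones: if the backward image of `u ≠ 0` were in
`C`, then `u` itself would be in the interior of `C`. -/
theorem FWW.exists_margin_coCone (hΦ : FWW k C Φ) (hK : IsCompact K) :
    ∃ ε : ℝ, 0 < ε ∧ ∀ y ∈ K, ∀ u ∈ coCone C, u ≠ 0 → ∀ w,
      ‖w - flowDeriv Φ (-1) y u‖ ≤ ε * ‖flowDeriv Φ (-1) y u‖ → w ∈ Cᶜ := by
  refine exists_uniform_margin (flowDeriv Φ (-1))
    ((continuous_flowDeriv hΦ.contDiff).comp (continuous_const.prodMk continuous_id)) hK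
    isClosed_coCone hΦ.isKCone.isClosed.isOpen_compl
    (fun _ hv => hΦ.isKCone.smul_mem_coCone hv) (fun _ hv _ hl => hΦ.isKCone.compl_smul_mem hv hl)
    fun y _ u hu h0 hmem => ?_
  have := hΦ.deriv_mem_interior one_pos (Φ (-1) y) hmem
    (flowDeriv_ne_zero hΦ.contDiff _ _ h0)
  rw [flowDeriv_flowDeriv_neg hΦ.contDiff] at this
  exact h0 (mem_coCone.1 hu this)

/-- The vectors whose full orbit under the linearised flow stays in `C` form a subspace. -/
theorem FWW.exists_dominantSpace (hΦ : FWW k C Φ) (hK : IsCompact K)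
    (hinv : ∀ t : ℝ, ∀ y ∈ K, Φ t y ∈ K) {y : V} (hy : y ∈ K) :
    ∃ L : Submodule ℝ V, ∀ v, v ∈ L ↔ ∀ t : ℝ, flowDeriv Φ t y v ∈ C := by
  obtain ⟨ε, hε, hm⟩ := hΦ.exists_margin hK
  have hcd := hΦ.contDiff
  refine ⟨⟨⟨⟨{v | ∀ t : ℝ, flowDeriv Φ t y v ∈ C}, ?_⟩, ?_⟩, ?_⟩, fun v => Iff.rfl⟩
  · intro e v he hv t
    -- Membership in `C` propagates forward in time, so the times `-n` suffice.
    obtain ⟨n, hn⟩ := exists_nat_ge (-t)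
    refine hΦ.deriv_mem_of_le (s := -(n : ℝ)) (by linarith) ?_
    refine add_mem_of_orbit_mem hΦ.isKCone.isClosed hΦ.isKCone.smul_mem
      (fun n : ℕ => flowDeriv Φ (-(n : ℝ)) y) hε ?_ (fun n => he _) (fun n => hv _) n
    intro n u w hu hw
    rcases eq_or_ne u 0 with rfl | h0
    · have : w = 0 := by simpa using hw
      exact this ▸ hΦ.isKCone.zero_mem
    have key : flowDeriv Φ (-(n : ℝ)) y u =
        flowDeriv Φ 1 (Φ (-((n + 1 : ℕ) : ℝ)) y) (flowDeriv Φ (-((n + 1 : ℕ) : ℝ)) y u) := by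
      rw [← flowDeriv_add hcd]; congr 2; push_cast; ring
    rw [key] at hw
    exact interior_subset (hm _ (hinv _ y hy) _ hu (flowDeriv_ne_zero hcd _ _ h0) w hw)
  · intro t; simpa using hΦ.isKCone.zero_mem
  · intro c v hv t
    rw [map_smul]; exact hΦ.isKCone.smul_mem _ (hv t) c

/-- The vectors whose forward orbit under the linearised flow stays in the complementary cone form
a subspace. -/
theorem FWW.exists_dominatedSpace (hΦ : FWW k C Φ) (hK : IsCompact K)
    (hinv : ∀ t : ℝ, ∀ y ∈ K, Φ t y ∈ K) {y : V} (hy : y ∈ K) :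
    ∃ L : Submodule ℝ V, ∀ v, v ∈ L ↔ ∀ n : ℕ, flowDeriv Φ n y v ∈ coCone C := by
  obtain ⟨ε, hε, hm⟩ := hΦ.exists_margin_coCone hK
  have hcd := hΦ.contDiff
  have hzero : (0 : V) ∈ coCone C := mem_coCone.2 fun _ => rfl
  refine ⟨⟨⟨⟨{v | ∀ n : ℕ, flowDeriv Φ n y v ∈ coCone C}, ?_⟩, ?_⟩, ?_⟩, fun v => Iff.rfl⟩
  · intro e v he hv n
    refine add_mem_of_orbit_mem isClosed_coCone (fun _ hv => hΦ.isKCone.smul_mem_coCone hv)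
      (fun n : ℕ => flowDeriv Φ (n : ℝ) y) hε ?_ he hv n
    intro n u w hu hw
    rcases eq_or_ne u 0 with rfl | h0
    · have : w = 0 := by simpa using hw
      exact this ▸ hzero
    have key : flowDeriv Φ (n : ℝ) y u =
        flowDeriv Φ (-1) (Φ ((n + 1 : ℕ) : ℝ) y) (flowDeriv Φ ((n + 1 : ℕ) : ℝ) y u) := by
      rw [← flowDeriv_add hcd]; congr 2; push_cast; ring
    rw [key] at hw
    have := hm _ (hinv _ y hy) _ hu (flowDeriv_ne_zero hcd _ _ h0) w hw
    exact mem_coCone.2 fun h => absurd (interior_subset h) this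
  · intro n; simpa using hzero
  · intro c v hv n
    rw [map_smul]; exact hΦ.isKCone.smul_mem_coCone (hv n) c

end Invariance

/-! ### Existence of the exponential separation. -/

section Separation

variable {V : Type*} [NormedAddCommGroup V] [NormedSpace ℝ V] [FiniteDimensional ℝ V] {k : ℕ}
  {C : Set V} {Φ : Flow ℝ V} {K : Set V} {E F : V → Submodule ℝ V}

/-- Along an invariant compact set the bundle `E` lies uniformly inside the cone, and makes an angle
with `F` that is bounded from below. -/
theorem FWW.exists_angle (hΦ : FWW k C Φ) (hK : IsCompact K)
    (hinv : ∀ t : ℝ, ∀ y ∈ K, Φ t y ∈ K)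
    (hE : ∀ y ∈ K, ∀ v ∈ E y, ∃ v' ∈ C, flowDeriv Φ 1 (Φ (-1) y) v' = v)
    (hF : ∀ y ∈ K, ∀ w ∈ F y, w ∈ C → w = 0) :
    ∃ η : ℝ, 0 < η ∧ (∀ y ∈ K, ∀ v ∈ E y, ∀ w, ‖w‖ ≤ η * ‖v‖ → v + w ∈ C) ∧
      ∀ y ∈ K, ∀ v ∈ E y, ∀ w ∈ F y, η * ‖v‖ ≤ ‖v + w‖ ∧ η * ‖w‖ ≤ ‖v + w‖ := by
  obtain ⟨ε, hε, hm⟩ := hΦ.exists_margin hK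
  set ρ := min ε 1 with hρ
  have hρ0 : 0 < ρ := by positivity
  have hρε : ρ ≤ ε := min_le_left _ _
  have hρ1 : ρ ≤ 1 := min_le_right _ _
  have h1 : ∀ y ∈ K, ∀ v ∈ E y, ∀ w, ‖w‖ ≤ ρ * ‖v‖ → v + w ∈ C := by
    intro y hy v hv w hw
    obtain ⟨v', hv', rfl⟩ := hE y hy v hv
    rcases eq_or_ne v' 0 with rfl | h0
    · have : w = 0 := by simpa using hw
      simpa [this] using hΦ.isKCone.zero_mem
    refine interior_subset (hm (Φ (-1) y) (hinv (-1) y hy) v' hv' h0 _ ?_)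
    rw [add_sub_cancel_left]
    exact hw.trans (by gcongr)
  -- Were `v + w` shorter than `ρ * ‖v‖`, then `v - (v + w) = -w` would lie in `C`, forcing `w = 0`.
  have h2 : ∀ y ∈ K, ∀ v ∈ E y, ∀ w ∈ F y, ρ * ‖v‖ ≤ ‖v + w‖ := by
    intro y hy v hv w hw
    by_contra! hlt
    have h3 := h1 y hy v hv (-(v + w)) (by rw [norm_neg]; exact hlt.le)
    have h4 : w ∈ C := by
      have := hΦ.isKCone.smul_mem _ h3 (-1)
      simpa using this
    rw [hF y hy w hw h4, add_zero] at hlt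
    nlinarith [norm_nonneg v]
  refine ⟨ρ / 2, by positivity, fun y hy v hv w hw => h1 y hy v hv w (hw.trans ?_),
    fun y hy v hv w hw => ?_⟩
  · gcongr; linarith
  · have h3 := h2 y hy v hv w hw
    have h4 : ‖w‖ ≤ ‖v + w‖ + ‖v‖ := by
      calc ‖w‖ = ‖(v + w) - v‖ := by congr 1; abel
        _ ≤ _ := norm_sub_le _ _
    constructor
    · nlinarith [norm_nonneg v]
    · nlinarith [norm_nonneg v, norm_nonneg w, norm_nonneg (v + w)]

/-- The margin leaves room to enlarge the `F`-component by a fixed factor `q > 1` at each unit step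
without leaving `C`. Vectors of `C` have a relatively bounded `F`-component, so after `n` steps the
true `F`-component must have become smaller by a factor of order `q ^ n`. -/
theorem FWW.exists_domination (hΦ : FWW k C Φ) (hK : IsCompact K)
    (hinv : ∀ t : ℝ, ∀ y ∈ K, Φ t y ∈ K)
    (hE : ∀ y ∈ K, ∀ v, v ∈ E y ↔ ∀ t : ℝ, flowDeriv Φ t y v ∈ C)
    (hF : ∀ y ∈ K, ∀ v, v ∈ F y ↔ ∀ t : ℝ, 0 ≤ t → flowDeriv Φ t y v ∈ coCone C) :
    ∃ M γ : ℝ, 0 < M ∧ 0 < γ ∧ γ < 1 ∧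
      ∀ x ∈ K, ∀ w ∈ F x, ‖w‖ = 1 → ∀ v ∈ E x, ‖v‖ = 1 → ∀ t : ℝ, 0 ≤ t →
        ‖flowDeriv Φ t x w‖ ≤ M * γ ^ t * ‖flowDeriv Φ t x v‖ := by
  have hcd := hΦ.contDiff
  have hEt : ∀ y ∈ K, ∀ v ∈ E y, ∀ t : ℝ, flowDeriv Φ t y v ∈ E (Φ t y) := by
    intro y hy v hv t
    rw [hE _ (hinv t y hy)]
    intro s
    rw [← flowDeriv_add hcd]
    exact (hE y hy v).1 hv _
  have hFt : ∀ y ∈ K, ∀ v ∈ F y, ∀ t : ℝ, 0 ≤ t → flowDeriv Φ t y v ∈ F (Φ t y) := by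
    intro y hy v hv t ht
    rw [hF _ (hinv t y hy)]
    intro s hs
    rw [← flowDeriv_add hcd]
    exact (hF y hy v).1 hv _ (by positivity)
  have hF0 : ∀ y ∈ K, ∀ w ∈ F y, w ∈ C → w = 0 := by
    intro y hy w hw hwC
    by_contra h0
    have h1 := mem_coCone.1 ((hF y hy w).1 hw 1 zero_le_one) (hΦ.deriv_mem_interior one_pos y hwC h0)
    exact flowDeriv_ne_zero hcd _ _ h0 h1
  obtain ⟨η, hη, hη1, hη2⟩ := hΦ.exists_angle (E := E) (F := F) hK hinv (fun y hy v hv =>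
    ⟨flowDeriv Φ (-1) y v, (hE y hy v).1 hv _, flowDeriv_flowDeriv_neg hcd _ _ _⟩) hF0
  obtain ⟨ε, hε, hm⟩ := hΦ.exists_margin hK
  obtain ⟨ε', hε', hm'⟩ := hΦ.exists_margin_coCone hK
  set δ := ε * η with hδ
  have hδ0 : 0 < δ := by positivity
  set q := 1 + δ with hq
  have hq0 : 0 < q := by positivity
  have hstep : ∀ y ∈ K, ∀ v ∈ E y, ∀ w ∈ F y, v ≠ 0 → v + w ∈ C →
      flowDeriv Φ 1 y v + q • flowDeriv Φ 1 y w ∈ C := by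
    intro y hy v hv w hw hv0 hvw
    have h0 : v + w ≠ 0 := by
      intro h
      have := (hη2 y hy v hv w hw).1
      rw [h, norm_zero] at this
      have : 0 < η * ‖v‖ := by positivity
      linarith
    refine interior_subset (hm y hy _ hvw h0 _ ?_)
    have h1 := (hη2 _ (hinv 1 y hy) _ (hEt y hy v hv 1) _ (hFt y hy w hw 1 zero_le_one)).2
    have h2 : flowDeriv Φ 1 y v + q • flowDeriv Φ 1 y w - flowDeriv Φ 1 y (v + w) =
        δ • flowDeriv Φ 1 y w := by
      rw [map_add, hq, add_smul, one_smul]; abel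
    rw [h2, norm_smul, Real.norm_eq_abs, abs_of_pos hδ0, map_add, hδ, mul_assoc]
    gcongr
  have hind : ∀ x ∈ K, ∀ v ∈ E x, ∀ w ∈ F x, ‖v‖ = 1 → ‖w‖ = 1 → ∀ n : ℕ,
      flowDeriv Φ n x (v + (η * q ^ n) • w) ∈ C := by
    intro x hx v hv w hw hv1 hw1 n
    induction n with
    | zero =>
      rw [Nat.cast_zero, flowDeriv_zero]
      refine hη1 x hx v hv _ ?_
      rw [norm_smul, hv1, hw1, pow_zero, Real.norm_eq_abs, abs_of_pos (by positivity)]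
      linarith
    | succ n ih =>
      have hv0 : v ≠ 0 := by rintro rfl; simp at hv1
      have hn : (0 : ℝ) ≤ n := n.cast_nonneg
      rw [map_add, map_smul] at ih
      have := hstep _ (hinv n x hx) _ (hEt x hx v hv n) _
        (Submodule.smul_mem _ _ (hFt x hx w hw n hn)) (flowDeriv_ne_zero hcd n x hv0) ih
      rw [map_smul, ← flowDeriv_add hcd, ← flowDeriv_add hcd, smul_smul] at this
      rw [map_add, map_smul, Nat.cast_succ, add_comm (n : ℝ) 1]
      convert this using 3
      ring
  -- Otherwise `v + w` is within the backward margin of `w`, the time minus one image of a vector of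
  -- the complementary cone, and so is outside `C`.
  have hF' : ∀ y ∈ K, ∀ w ∈ F y, ∀ v, v + w ∈ C → ε' * ‖w‖ ≤ ‖v‖ := by
    intro y hy w hw v hvw
    by_contra! hlt
    have hw0 : w ≠ 0 := by rintro rfl; simp at hlt; exact absurd (norm_nonneg v) (not_le.2 hlt)
    have key := flowDeriv_neg_flowDeriv hcd 1 y w
    refine hm' (Φ 1 y) (hinv 1 y hy) (flowDeriv Φ 1 y w) ((hF y hy w).1 hw 1 zero_le_one)
      (flowDeriv_ne_zero hcd _ _ hw0) (v + w) ?_ hvw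
    rw [key, add_sub_cancel_right]
    exact hlt.le
  -- The extra factor `q` pays for replacing `t` by its integer part.
  refine ⟨q / (η * ε'), q⁻¹, by positivity, by positivity,
    inv_lt_one_of_one_lt₀ (by linarith), fun x hx w hw hw1 v hv hv1 t ht => ?_⟩
  have h1 := hΦ.deriv_mem_of_le (Nat.floor_le ht) (hind x hx v hv w hw hv1 hw1 ⌊t⌋₊)
  rw [map_add, map_smul] at h1
  have h2 := hF' _ (hinv t x hx) _ (Submodule.smul_mem _ _ (hFt x hx w hw t ht)) _ h1
  rw [norm_smul, Real.norm_eq_abs, abs_of_pos (by positivity)] at h2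
  have h3 : q ^ (t - 1) ≤ q ^ ⌊t⌋₊ := by
    rw [← Real.rpow_natCast]
    exact Real.rpow_le_rpow_of_exponent_le (by linarith) (by linarith [Nat.lt_floor_add_one t])
  rw [Real.rpow_sub_one hq0.ne'] at h3
  have h4 : 0 < q ^ t := Real.rpow_pos_of_pos hq0 t
  rw [Real.inv_rpow hq0.le]
  have h5 : ε' * (η * (q ^ t / q) * ‖flowDeriv Φ t x w‖) ≤ ‖flowDeriv Φ t x v‖ :=
    le_trans (by gcongr) h2
  calc ‖flowDeriv Φ t x w‖ = q / (η * ε') * (q ^ t)⁻¹ *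
        (ε' * (η * (q ^ t / q) * ‖flowDeriv Φ t x w‖)) := by field_simp
    _ ≤ _ := by gcongr

/-- The fibres of the dominant and the dominated bundles span the whole space: a `k + 1`-dimensional
subspace is never mapped into `C`, so it meets the dominated fibre. -/
theorem FWW.isCompl_of_mem_iff (hΦ : FWW k C Φ) {y : V} {L N : Submodule ℝ V}
    (hL : ∀ v, v ∈ L ↔ ∀ t : ℝ, flowDeriv Φ t y v ∈ C)
    (hN : ∀ v, v ∈ N ↔ ∀ n : ℕ, flowDeriv Φ n y v ∈ coCone C)
    (hdim : Module.finrank ℝ L = k) : IsCompl L N := by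
  have hcd := hΦ.contDiff
  have hdisj : ∀ v ∈ L, v ∈ N → v = 0 := by
    intro v hv hv'
    by_contra h0
    have h1 := hΦ.deriv_mem_interior_of_lt one_pos h0 ((hL v).1 hv 0)
    have h2 := (hN v).1 hv' 1
    rw [Nat.cast_one] at h2
    exact flowDeriv_ne_zero hcd _ _ h0 (mem_coCone.1 h2 h1)
  refine ⟨Submodule.disjoint_def.2 hdisj, codisjoint_iff.2 (eq_top_iff.2 fun v _ => ?_)⟩
  by_cases hv : v ∈ L
  · exact Submodule.mem_sup_left hv
  set P := L ⊔ Submodule.span ℝ {v} with hP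
  have hPdim : k < Module.finrank ℝ P := by
    rw [← hdim]
    refine Submodule.finrank_lt_finrank_of_lt (lt_of_le_of_ne le_sup_left fun h => hv ?_)
    rw [h]
    exact Submodule.mem_sup_right (Submodule.mem_span_singleton_self v)
  -- The image of `P` has dimension above `k`, so it is not contained in `C`. Compactness of the
  -- unit sphere then gives one `u` for all `n`; it lies in `N`, and its `v`-coefficient is nonzero
  -- because `L` meets `N` trivially.
  have hex : ∀ n : ℕ, ∃ u ∈ P, ‖u‖ = 1 ∧ flowDeriv Φ n y u ∈ coCone C := by
    intro n
    by_contra! hcon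
    have hsub : ((P.map (flowDeriv Φ n y : V →ₗ[ℝ] V) : Submodule ℝ V) : Set V) ⊆ C := by
      rintro _ ⟨u, hu, rfl⟩
      rcases eq_or_ne u 0 with rfl | h0
      · simpa using hΦ.isKCone.zero_mem
      have hn : ‖u‖ ≠ 0 := norm_ne_zero_iff.2 h0
      have h1 := hcon (‖u‖⁻¹ • u) (P.smul_mem _ hu) (by simp [norm_smul, hn])
      rw [map_smul] at h1
      by_contra hu'
      exact h1 (hΦ.isKCone.smul_mem_coCone
        (mem_coCone.2 fun h => absurd (interior_subset h) hu') _)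
    have h2 := hΦ.isKCone.rank.2 ⟨_, hsub, rfl⟩
    have h3 : Module.finrank ℝ (P.map (flowDeriv Φ n y : V →ₗ[ℝ] V)) = Module.finrank ℝ P :=
      finrank_map_of_injective (flowDeriv_injective hcd n y) P
    omega
  let X : ℕ → Set V := fun n => {u | u ∈ P ∧ ‖u‖ = 1 ∧ flowDeriv Φ n y u ∈ coCone C}
  have hXc : ∀ n, IsClosed (X n) := fun n =>
    (Submodule.closed_of_finiteDimensional P).inter
      ((isClosed_eq continuous_norm continuous_const).inter
        (isClosed_coCone.preimage (flowDeriv Φ n y).continuous))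
  obtain ⟨u, hu⟩ := IsCompact.nonempty_iInter_of_sequence_nonempty_isCompact_isClosed X
    (fun n u hu => ⟨hu.1, hu.2.1, hΦ.mem_coCone_of_le (by push_cast; linarith) hu.2.2⟩) hex
    ((isCompact_sphere (0 : V) 1).of_isClosed_subset (hXc 0) fun u hu => by simpa using hu.2.1) hXc
  rw [mem_iInter] at hu
  have huN : u ∈ N := (hN u).2 fun n => (hu n).2.2
  obtain ⟨e, he, w, hw, hew⟩ := Submodule.mem_sup.1 (hu 0).1
  obtain ⟨c, rfl⟩ := Submodule.mem_span_singleton.1 hw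
  have hc : c ≠ 0 := by
    rintro rfl
    rw [zero_smul, add_zero] at hew
    have h1 := (hu 0).2.1
    rw [hdisj u (hew ▸ he) huN, norm_zero] at h1
    exact zero_ne_one h1
  have hv' : v = -(c⁻¹ • e) + c⁻¹ • u := by
    rw [← hew, smul_add, smul_smul, inv_mul_cancel₀ hc, one_smul]; abel
  rw [hv']
  exact Submodule.add_mem_sup (L.neg_mem (L.smul_mem _ he)) (N.smul_mem _ huN)

/-- The fibres of the dominant bundle have dimension `k`. -/
theorem FWW.finrank_dominantSpace (hΦ : FWW k C Φ) {y : V} {L : Submodule ℝ V}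
    (hL : ∀ v, v ∈ L ↔ ∀ t : ℝ, flowDeriv Φ t y v ∈ C) : Module.finrank ℝ L = k := by
  have hcd := hΦ.contDiff
  refine le_antisymm (hΦ.isKCone.rank.2 ⟨L, fun v hv => ?_, rfl⟩) ?_
  · have := (hL v).1 hv 0
    rwa [flowDeriv_zero] at this
  obtain ⟨W, hWk, hWC⟩ := hΦ.isKSolid
  refine le_finrank_of_decreasing (fun n : ℕ => {v | flowDeriv Φ (-(n : ℝ)) y v ∈ C})
    (fun n => hΦ.isKCone.isClosed.preimage (flowDeriv Φ _ y).continuous)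
    (fun n v hv => hΦ.deriv_mem_of_le (by push_cast; linarith) hv) (fun n => ?_) L
    fun v hv => (hL v).2 fun t => ?_
  -- The solid subspace `W`, pushed forward from time `-n`, returns to `W ⊆ C` at that time.
  · refine ⟨W.map (flowDeriv Φ n (Φ (-(n : ℝ)) y) : V →ₗ[ℝ] V), ?_, ?_⟩
    · rw [← hWk]
      exact finrank_map_of_injective (flowDeriv_injective hcd n _) W
    · rintro _ ⟨w, hw, rfl⟩
      have h1 : flowDeriv Φ (-(n : ℝ)) y (flowDeriv Φ n (Φ (-(n : ℝ)) y) w) = w := by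
        have := flowDeriv_neg_flowDeriv hcd n (Φ (-(n : ℝ)) y) w
        rwa [flow_flow_neg] at this
      change flowDeriv Φ (-(n : ℝ)) y (flowDeriv Φ n (Φ (-(n : ℝ)) y) w) ∈ C
      rw [h1]
      rcases eq_or_ne w 0 with rfl | h0
      · exact hΦ.isKCone.zero_mem
      · exact interior_subset (hWC ⟨hw, h0⟩)
  · obtain ⟨n, hn⟩ := exists_nat_ge (-t)
    exact hΦ.deriv_mem_of_le (s := -(n : ℝ)) (by linarith) (hv n)

/-- A flow with cone-preserving derivatives has an exponential separation along every compact
invariant set. -/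
theorem FWW.exists_isExpSeparation (hΦ : FWW k C Φ) (hK : IsCompact K)
    (hinv : ∀ t : ℝ, ∀ y ∈ K, Φ t y ∈ K) :
    ∃ E F : V → Submodule ℝ V, IsExpSeparation k C Φ K E F := by
  have hcd := hΦ.contDiff
  have hcont := continuous_flowDeriv hcd
  -- Fibres off `K` are irrelevant and are set to `⊥`.
  have hE : ∀ y, ∃ L : Submodule ℝ V, y ∈ K → ∀ v, v ∈ L ↔ ∀ t : ℝ, flowDeriv Φ t y v ∈ C := by
    intro y
    by_cases hy : y ∈ K
    · obtain ⟨L, hL⟩ := hΦ.exists_dominantSpace hK hinv hy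
      exact ⟨L, fun _ => hL⟩
    · exact ⟨⊥, fun h => absurd h hy⟩
  have hF : ∀ y, ∃ L : Submodule ℝ V, y ∈ K →
      ∀ v, v ∈ L ↔ ∀ n : ℕ, flowDeriv Φ n y v ∈ coCone C := by
    intro y
    by_cases hy : y ∈ K
    · obtain ⟨L, hL⟩ := hΦ.exists_dominatedSpace hK hinv hy
      exact ⟨L, fun _ => hL⟩
    · exact ⟨⊥, fun h => absurd h hy⟩
  choose E hE using hE
  choose F hF using hF
  have hF' : ∀ y ∈ K, ∀ v, v ∈ F y ↔ ∀ t : ℝ, 0 ≤ t → flowDeriv Φ t y v ∈ coCone C := by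
    intro y hy v
    rw [hF y hy]
    refine ⟨fun h t _ => ?_, fun h n => h n n.cast_nonneg⟩
    obtain ⟨n, hn⟩ := exists_nat_ge t
    exact hΦ.mem_coCone_of_le hn (h n)
  have hdimE : ∀ y ∈ K, Module.finrank ℝ (E y) = k := fun y hy =>
    hΦ.finrank_dominantSpace (hE y hy)
  have hcompl : ∀ y ∈ K, IsCompl (E y) (F y) := fun y hy =>
    hΦ.isCompl_of_mem_iff (hE y hy) (hF y hy) (hdimE y hy)
  have hev : ∀ t : ℝ, Continuous fun p : V × V => flowDeriv Φ t p.1 p.2 := fun t =>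
    (hcont.comp (continuous_const.prodMk continuous_fst)).clm_apply continuous_snd
  refine ⟨E, F, ?_, ?_, hcompl, ?_, ?_, hΦ.exists_domination hK hinv hE hF', ?_, ?_⟩
  · refine isContinuousBundle_of_isClosed hdimE (Γ := ⋂ t : ℝ, {p | flowDeriv Φ t p.1 p.2 ∈ C})
      (isClosed_iInter fun t => hΦ.isKCone.isClosed.preimage (hev t)) fun y hy v => ?_
    rw [hE y hy, mem_iInter]; rfl
  · refine isContinuousBundle_of_isClosed (fun y hy => ?_)
      (Γ := ⋂ n : ℕ, {p | flowDeriv Φ n p.1 p.2 ∈ coCone C})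
      (isClosed_iInter fun n => isClosed_coCone.preimage (hev n)) fun y hy v => ?_
    · have := Submodule.finrank_add_eq_of_isCompl (hcompl y hy)
      have := hdimE y hy
      omega
    · rw [hF y hy, mem_iInter]; rfl
  · intro y hy t _
    ext v
    rw [hE _ (hinv t y hy), Submodule.mem_map]
    constructor
    · rintro ⟨u, hu, rfl⟩ s
      rw [ContinuousLinearMap.coe_coe, ← flowDeriv_add hcd]
      exact (hE y hy u).1 hu _
    · intro h
      have h1 := flowDeriv_flowDeriv_neg hcd t (Φ t y) v
      rw [flow_neg_flow] at h1
      refine ⟨flowDeriv Φ (-t) (Φ t y) v, (hE y hy _).2 fun s => ?_, h1⟩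
      have h2 := flowDeriv_add hcd s (-t) (Φ t y) v
      rw [flow_neg_flow] at h2
      rw [← h2]
      exact h _
  · rintro y hy t ht _ ⟨u, hu, rfl⟩
    rw [hF' _ (hinv t y hy)]
    intro s hs
    rw [ContinuousLinearMap.coe_coe, ← flowDeriv_add hcd]
    exact (hF' y hy u).1 hu _ (by positivity)
  · intro y hy v hv
    rcases eq_or_ne v 0 with rfl | h0
    · exact Or.inr rfl
    have h1 := hΦ.deriv_mem_interior_of_lt (s := -1) (t := 0) (by norm_num) h0
      ((hE y hy v).1 hv (-1))
    rw [flowDeriv_zero] at h1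
    exact Or.inl h1
  · intro y hy
    ext v
    simp only [mem_inter_iff, SetLike.mem_coe, mem_singleton_iff]
    constructor
    · rintro ⟨hv, hvC⟩
      by_contra h0
      exact flowDeriv_ne_zero hcd 1 y h0
        (mem_coCone.1 ((hF' y hy v).1 hv 1 zero_le_one) (hΦ.deriv_mem_interior one_pos y hvC h0))
    · rintro rfl
      exact ⟨(F y).zero_mem, hΦ.isKCone.zero_mem⟩

end Separation

/-! ### Nonlinear estimates near a point with nonpositive exponent. -/

section Local

variable {V : Type*} [NormedAddCommGroup V] [NormedSpace ℝ V] {k : ℕ}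
  {C : Set V} {Φ : Flow ℝ V} {K : Set V} {E F : V → Submodule ℝ V}

/-- The first order Taylor remainder of the time-one map is uniformly of order `1 + α` along a
compact set. -/
theorem IsC1Holder.exists_remainder_bound {α : ℝ≥0} (h : IsC1Holder α Φ) (hK : IsCompact K) :
    ∃ r L : ℝ, 0 < r ∧ 0 ≤ L ∧ ∀ z ∈ K, ∀ d : V, ‖d‖ ≤ r →
      ‖Φ 1 (z + d) - Φ 1 z - flowDeriv Φ 1 z d‖ ≤ L * ‖d‖ ^ (α : ℝ) * ‖d‖ := by
  refine hK.induction_on (p := fun S => ∃ r L : ℝ, 0 < r ∧ 0 ≤ L ∧ ∀ z ∈ S, ∀ d : V, ‖d‖ ≤ r →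
      ‖Φ 1 (z + d) - Φ 1 z - flowDeriv Φ 1 z d‖ ≤ L * ‖d‖ ^ (α : ℝ) * ‖d‖) ?_ ?_ ?_ ?_
  · exact ⟨1, 0, one_pos, le_rfl, fun z hz => absurd hz (notMem_empty z)⟩
  · rintro S T hST ⟨r, L, hr, hL, H⟩
    exact ⟨r, L, hr, hL, fun z hz => H z (hST hz)⟩
  · rintro S T ⟨r, L, hr, hL, H⟩ ⟨r', L', hr', hL', H'⟩
    refine ⟨min r r', max L L', lt_min hr hr', le_max_of_le_left hL, fun z hz d hd => ?_⟩
    rcases hz with hz | hz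
    · exact (H z hz d (hd.trans (min_le_left _ _))).trans (by gcongr; exact le_max_left _ _)
    · exact (H' z hz d (hd.trans (min_le_right _ _))).trans (by gcongr; exact le_max_right _ _)
  · intro z₀ _
    obtain ⟨U, hU, L, hL⟩ := h.2 (1, z₀)
    obtain ⟨ρ, hρ, hball⟩ := Metric.mem_nhds_iff.1 hU
    refine ⟨Metric.ball z₀ (ρ / 2), nhdsWithin_le_nhds (Metric.ball_mem_nhds _ (by positivity)),
      ρ / 3, L, by positivity, L.2, fun z hz d hd => ?_⟩
    have hmem : ∀ ξ ∈ Metric.closedBall z ‖d‖, ((1 : ℝ), ξ) ∈ U := by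
      intro ξ hξ
      refine hball ?_
      rw [Metric.mem_ball, Prod.dist_eq, dist_self, max_lt_iff]
      refine ⟨hρ, (dist_triangle ξ z z₀).trans_lt ?_⟩
      rw [Metric.mem_closedBall] at hξ
      rw [Metric.mem_ball] at hz
      linarith
    have hz' : z ∈ Metric.closedBall z ‖d‖ := Metric.mem_closedBall_self (norm_nonneg d)
    have hbound : ∀ ξ ∈ Metric.closedBall z ‖d‖,
        ‖flowDeriv Φ 1 ξ - flowDeriv Φ 1 z‖ ≤ L * ‖d‖ ^ (α : ℝ) := by
      intro ξ hξ
      have h1 := hL.dist_le (hmem ξ hξ) (hmem z hz')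
      rw [dist_eq_norm] at h1
      rw [flowDeriv_eq h.1, flowDeriv_eq h.1, ← ContinuousLinearMap.sub_comp]
      have hinr : ‖ContinuousLinearMap.inr ℝ ℝ V‖ ≤ 1 :=
        ContinuousLinearMap.norm_inr_le_one ℝ ℝ V
      refine ((ContinuousLinearMap.opNorm_comp_le _ _).trans
        (mul_le_of_le_one_right (norm_nonneg _) hinr)).trans (h1.trans ?_)
      gcongr
      rw [Prod.dist_eq, dist_self, max_eq_right dist_nonneg]
      exact hξ
    -- Mean value inequality for `Φ 1` minus its linearisation at `z`; the radii `ρ / 2` and `ρ / 3`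
    -- keep the ball inside the Hölder neighbourhood.
    have h2 := (convex_closedBall z ‖d‖).norm_image_sub_le_of_norm_hasFDerivWithin_le'
      (f := Φ 1) (f' := flowDeriv Φ 1) (φ := flowDeriv Φ 1 z) (C := L * ‖d‖ ^ (α : ℝ))
      (x := z) (y := z + d)
      (fun ξ _ => (hasFDerivAt_flowDeriv h.1 1 ξ).hasFDerivWithinAt) hbound hz'
      (by simp)
    simpa using h2

/-- The infimum norm of an operator on a nontrivial subspace is attained. -/
theorem exists_infNorm_eq [FiniteDimensional ℝ V] (A : V →L[ℝ] V) {L : Submodule ℝ V} (hL : L ≠ ⊥) :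
    (∃ v ∈ L, ‖v‖ = 1 ∧ infNorm A L = ‖A v‖) ∧ ∀ u ∈ L, infNorm A L * ‖u‖ ≤ ‖A u‖ := by
  have hc : IsCompact ((L : Set V) ∩ Metric.sphere 0 1) :=
    (isCompact_sphere 0 1).inter_left (Submodule.closed_of_finiteDimensional L)
  have hunit : ∀ u ∈ L, u ≠ 0 → ‖u‖⁻¹ • u ∈ (L : Set V) ∩ Metric.sphere 0 1 := fun u hu h0 =>
    ⟨L.smul_mem _ hu, by simp [norm_smul, h0]⟩
  obtain ⟨u₀, hu₀, h0⟩ := Submodule.exists_mem_ne_zero_of_ne_bot hL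
  have hcont : ContinuousOn (fun v => ‖A v‖) ((L : Set V) ∩ Metric.sphere 0 1) := by fun_prop
  obtain ⟨v, hv, hmin⟩ := hc.exists_sInf_image_eq ⟨_, hunit u₀ hu₀ h0⟩ hcont
  have hbdd : BddBelow ((fun v => ‖A v‖) '' ((L : Set V) ∩ Metric.sphere 0 1)) :=
    ⟨0, by rintro _ ⟨v, -, rfl⟩; exact norm_nonneg _⟩
  refine ⟨⟨v, hv.1, by simpa using hv.2, hmin⟩, fun u hu => ?_⟩
  rcases eq_or_ne u 0 with rfl | hu0
  · simp
  have hn : 0 < ‖u‖ := norm_pos_iff.2 hu0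
  have h1 : infNorm A L ≤ ‖A (‖u‖⁻¹ • u)‖ := csInf_le hbdd ⟨_, hunit u hu hu0, rfl⟩
  rw [map_smul, norm_smul, norm_inv, norm_norm, inv_mul_eq_div, le_div_iff₀ hn] at h1
  exact h1

theorem IsExpSeparation.deriv_mem_E (hs : IsExpSeparation k C Φ K E F) {y v : V} (hy : y ∈ K)
    (hv : v ∈ E y) {t : ℝ} (ht : 0 ≤ t) : flowDeriv Φ t y v ∈ E (Φ t y) := by
  rcases ht.eq_or_lt with rfl | h
  · rwa [flowDeriv_zero, Φ.map_zero_apply]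
  · rw [← hs.map_E y hy t h]
    exact ⟨v, hv, rfl⟩

theorem IsExpSeparation.deriv_mem_F (hs : IsExpSeparation k C Φ K E F) {y v : V} (hy : y ∈ K)
    (hv : v ∈ F y) {t : ℝ} (ht : 0 ≤ t) : flowDeriv Φ t y v ∈ F (Φ t y) := by
  rcases ht.eq_or_lt with rfl | h
  · rwa [flowDeriv_zero, Φ.map_zero_apply]
  · exact hs.map_F y hy t h ⟨v, hv, rfl⟩

theorem IsExpSeparation.exists_dominated (hs : IsExpSeparation k C Φ K E F) :
    ∃ M γ : ℝ, 0 < M ∧ 0 < γ ∧ γ < 1 ∧ ∀ y ∈ K, ∀ w ∈ F y, ∀ v ∈ E y, ∀ n : ℕ,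
      ‖flowDeriv Φ n y w‖ * ‖v‖ ≤ M * γ ^ n * ‖flowDeriv Φ n y v‖ * ‖w‖ := by
  obtain ⟨M, γ, hM, hγ, hγ1, h⟩ := hs.separation
  refine ⟨M, γ, hM, hγ, hγ1, fun y hy w hw v hv n => ?_⟩
  rcases eq_or_ne w 0 with rfl | hw0
  · simp
  rcases eq_or_ne v 0 with rfl | hv0
  · simp
  have hwn : 0 < ‖w‖ := norm_pos_iff.2 hw0
  have hvn : 0 < ‖v‖ := norm_pos_iff.2 hv0
  have h1 := h y hy (‖w‖⁻¹ • w) ((F y).smul_mem _ hw) (by simp [norm_smul, hw0])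
    (‖v‖⁻¹ • v) ((E y).smul_mem _ hv) (by simp [norm_smul, hv0]) n n.cast_nonneg
  rw [map_smul, map_smul, norm_smul, norm_smul, norm_inv, norm_inv, norm_norm, norm_norm,
    Real.rpow_natCast] at h1
  calc ‖flowDeriv Φ n y w‖ * ‖v‖ = (‖w‖⁻¹ * ‖flowDeriv Φ n y w‖) * (‖v‖ * ‖w‖) := by field_simp
    _ ≤ (M * γ ^ n * (‖v‖⁻¹ * ‖flowDeriv Φ n y v‖)) * (‖v‖ * ‖w‖) := by gcongr
    _ = _ := by field_simp

theorem flow_natCast_succ {X : Type*} [TopologicalSpace X] (Φ : Flow ℝ X) (n : ℕ) (y : X) :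
    Φ ((n + 1 : ℕ) : ℝ) y = Φ 1 (Φ n y) := by
  rw [← Φ.map_add]; congr 1; push_cast; ring

theorem flowDeriv_natCast_succ (h : ContDiff ℝ 1 (fun p : ℝ × V => Φ p.1 p.2)) (n : ℕ) (y v : V) :
    flowDeriv Φ ((n + 1 : ℕ) : ℝ) y v = flowDeriv Φ 1 (Φ n y) (flowDeriv Φ n y v) := by
  rw [← flowDeriv_add h]; congr 2; push_cast; ring

/-- Along a point with nonpositive `k`-Lyapunov exponent, the dominated bundle is contracted by
the weights `g n = γ ^ n * m n`, where `m` is the infimum norm on the dominant bundle. -/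
theorem IsExpSeparation.exists_weights [FiniteDimensional ℝ V] (hΦ : FWW k C Φ) (hK : IsCompact K)
    (hinv : ∀ t : ℝ, ∀ y ∈ K, Φ t y ∈ K) (hs : IsExpSeparation k C Φ K E F) {z : V} (hz : z ∈ K)
    (hlyap : lyapunovExponent Φ E z ≤ 0) :
    ∃ (M c ρ : ℝ) (g : ℕ → ℝ), 0 < M ∧ 0 < c ∧ 0 < ρ ∧ ρ < 1 ∧ (∀ n, 0 < g n) ∧
      (∀ n, c * g n ≤ g (n + 1)) ∧ (∀ᶠ n in atTop, g n ≤ ρ ^ n) ∧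
      ∀ j i : ℕ, ∀ w ∈ F (Φ j z), ‖flowDeriv Φ i (Φ j z) w‖ ≤ M * (g (j + i) / g j) * ‖w‖ := by
  have hcd := hΦ.contDiff
  obtain ⟨M, γ, hM, hγ, hγ1, hdom⟩ := hs.exists_dominated
  obtain ⟨c, hc, hlow⟩ := exists_le_norm_flowDeriv hcd hK
  have hEbot : ∀ y ∈ K, E y ≠ ⊥ := by
    intro y hy h
    have h1 := hs.bundle_E.finrank_eq y hy
    have h2 := hΦ.isKCone.one_le
    rw [h, finrank_bot] at h1
    omega
  set m : ℕ → ℝ := fun n => infNorm (flowDeriv Φ n z) (E z) with hm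
  have hmin := fun n : ℕ => (exists_infNorm_eq (flowDeriv Φ n z) (hEbot z hz)).1
  have hle : ∀ n : ℕ, ∀ u ∈ E z, m n * ‖u‖ ≤ ‖flowDeriv Φ n z u‖ := fun n =>
    (exists_infNorm_eq (flowDeriv Φ n z) (hEbot z hz)).2
  have hm0 : ∀ n, 0 < m n := by
    intro n
    obtain ⟨v, -, hv1, hv⟩ := hmin n
    rw [show m n = _ from hv, norm_pos_iff]
    exact flowDeriv_ne_zero hcd _ _ (by rintro rfl; simp at hv1)
  have hmc : ∀ n, c * m n ≤ m (n + 1) := by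
    intro n
    obtain ⟨v, hvE, hv1, hv⟩ := hmin (n + 1)
    have h1 := hle n v hvE
    rw [hv1, mul_one] at h1
    rw [show m (n + 1) = _ from hv, flowDeriv_natCast_succ hcd]
    exact (mul_le_mul_of_nonneg_left h1 hc.le).trans (hlow _ (hinv n z hz) _)
  -- The rate is the square root of `γ`: eventually `m n < γ ^ (-n / 2)`, since the exponent is
  -- below `-log γ / 2 > 0`.
  refine ⟨M, c * γ, Real.exp (Real.log γ / 2), fun n => γ ^ n * m n, hM, by positivity,
    Real.exp_pos _, ?_, fun n => mul_pos (pow_pos hγ n) (hm0 n), fun n => ?_, ?_, ?_⟩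
  · rw [Real.exp_lt_one_iff]
    linarith [Real.log_neg hγ hγ1]
  · calc c * γ * (γ ^ n * m n) = γ ^ (n + 1) * (c * m n) := by ring
      _ ≤ γ ^ (n + 1) * m (n + 1) := by have := hmc n; gcongr
  · have hlt : limsup (lyapunovQuotient Φ E z) atTop < ((-Real.log γ / 2 : ℝ) : EReal) := by
      refine lt_of_le_of_lt hlyap ?_
      rw [← EReal.coe_zero, EReal.coe_lt_coe_iff]
      linarith [Real.log_neg hγ hγ1]
    have hev := eventually_lt_of_limsup_lt hlt
    filter_upwards [tendsto_natCast_atTop_atTop.eventually hev, eventually_gt_atTop 0] with n hn hn0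
    have hn0' : (0 : ℝ) < n := Nat.cast_pos.2 hn0
    rw [lyapunovQuotient, EReal.coe_lt_coe_iff, div_lt_iff₀ hn0'] at hn
    have h1 : Real.log (m n) < -Real.log γ / 2 * n := hn
    rw [← Real.exp_log (mul_pos (pow_pos hγ n) (hm0 n)), ← Real.exp_nat_mul,
      Real.log_mul (pow_pos hγ n).ne' (hm0 n).ne', Real.log_pow]
    apply Real.exp_le_exp.2
    linarith
  · intro j i w hw
    -- Compare `w` with the time-`j` image of the minimiser `v` for time `j + i`: that image has
    -- norm at least `m j` and is carried to a vector of norm exactly `m (j + i)`.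
    obtain ⟨v, hvE, hv1, hv⟩ := hmin (j + i)
    have h1 := hdom _ (hinv j z hz) w hw _ (hs.deriv_mem_E hz hvE j.cast_nonneg) i
    have h2 := hle j v hvE
    rw [hv1, mul_one] at h2
    rw [← flowDeriv_add hcd, show (i : ℝ) + j = ((j + i : ℕ) : ℝ) by push_cast; ring, ← hv] at h1
    have h3 : ‖flowDeriv Φ i (Φ j z) w‖ * m j ≤ M * γ ^ i * m (j + i) * ‖w‖ :=
      le_trans (by gcongr) h1
    have hmj := hm0 j
    calc ‖flowDeriv Φ i (Φ j z) w‖ = ‖flowDeriv Φ i (Φ j z) w‖ * m j / m j := by field_simp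
      _ ≤ M * γ ^ i * m (j + i) * ‖w‖ / m j := by gcongr
      _ = M * (γ ^ (j + i) * m (j + i) / (γ ^ j * m j)) * ‖w‖ := by rw [pow_add]; field_simp

/-- Near a point with nonpositive `k`-Lyapunov exponent, orbits that never become ordered with
the orbit of the point are asymptotic to it. -/
theorem IsExpSeparation.exists_local_alternative [FiniteDimensional ℝ V] (hΦ : FWW k C Φ)
    (hK : IsCompact K)
    (hinv : ∀ t : ℝ, ∀ y ∈ K, Φ t y ∈ K) (hs : IsExpSeparation k C Φ K E F) {z : V} (hz : z ∈ K)
    (hlyap : lyapunovExponent Φ E z ≤ 0) :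
    ∃ r : ℝ, 0 < r ∧ ∀ y, ‖y - z‖ < r → (∀ n : ℕ, Φ n y - Φ n z ∉ C) →
      Tendsto (fun n : ℕ => Φ n y - Φ n z) atTop (𝓝 0) := by
  have hcd := hΦ.contDiff
  obtain ⟨α, hα0, -, hHolder⟩ := hΦ.smooth
  have hα : (0 : ℝ) < α := by exact_mod_cast hα0
  obtain ⟨r, L, hr, hL, hrem⟩ := hHolder.exists_remainder_bound hK
  obtain ⟨M, c, ρ, g, hM, hc, hρ, hρ1, hg, hgc, hgρ, hgF⟩ :=
    hs.exists_weights hΦ hK hinv hz hlyap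
  obtain ⟨η, hη, hη1, hη2⟩ := hΦ.exists_angle (E := E) (F := F) hK hinv (fun y hy v hv => by
    have h1 := hs.map_E _ (hinv (-1) y hy) 1 one_pos
    rw [flow_flow_neg] at h1
    rw [← h1] at hv
    obtain ⟨v', hv', hv''⟩ := hv
    refine ⟨v', ?_, hv''⟩
    rcases hs.E_subset _ (hinv (-1) y hy) hv' with h | h
    · exact interior_subset h
    · rw [mem_singleton_iff.1 h]; exact hΦ.isKCone.zero_mem) (fun y hy w hw hwC => by
    have : w ∈ (F y : Set V) ∩ C := ⟨hw, hwC⟩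
    rwa [hs.F_inter y hy] at this)
  have hg0 : Tendsto g atTop (𝓝 0) :=
    squeeze_zero' (Eventually.of_forall fun n => (hg n).le) hgρ
      (tendsto_pow_atTop_nhds_zero_of_lt_one hρ.le hρ1)
  obtain ⟨G, hG⟩ := hg0.bddAbove_range
  have hG' : ∀ n, g n ≤ G := fun n => hG ⟨n, rfl⟩
  have hG0 : 0 < G := (hg 0).trans_le (hG' 0)
  have hsum : Summable fun n => g n ^ (α : ℝ) := by
    have h1 : Summable fun n : ℕ => (ρ ^ (α : ℝ)) ^ n :=
      summable_geometric_of_lt_one (by positivity) (Real.rpow_lt_one hρ.le hρ1 hα)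
    refine h1.of_norm_bounded_eventually_nat ?_
    filter_upwards [hgρ] with n hn
    rw [Real.norm_eq_abs, abs_of_nonneg (Real.rpow_nonneg (hg n).le _)]
    calc g n ^ (α : ℝ) ≤ (ρ ^ n) ^ (α : ℝ) := by have := (hg n).le; gcongr
      _ = (ρ ^ (α : ℝ)) ^ n := by
        rw [← Real.rpow_natCast, ← Real.rpow_natCast, ← Real.rpow_mul hρ.le, ← Real.rpow_mul hρ.le,
          mul_comm]
  set S := ∑' n, g n ^ (α : ℝ) with hS
  have hS0 : 0 ≤ S := tsum_nonneg fun n => Real.rpow_nonneg (hg n).le _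
  set c₁ := 1 + η⁻¹ with hc₁
  have hc₁0 : 0 < c₁ := by positivity
  set D := η⁻¹ * L * c₁ ^ (α : ℝ) * c₁ * c⁻¹ with hD
  have hD0 : 0 ≤ D := by positivity
  -- The first bound keeps differences where the Taylor estimate holds; the second lets the
  -- accumulated remainder use only half of the target `b * g n`.
  obtain ⟨b, hb, hb1, hb2⟩ : ∃ b : ℝ, 0 < b ∧ c₁ * b * G ≤ r ∧ M * D * S * b ^ (α : ℝ) ≤ 1 / 2 := by
    have h1 : Tendsto (fun b : ℝ => c₁ * b * G) (𝓝[>] 0) (𝓝 0) := by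
      have : Tendsto (fun b : ℝ => c₁ * b * G) (𝓝 0) (𝓝 (c₁ * 0 * G)) :=
        Continuous.tendsto (by fun_prop) 0
      rw [mul_zero, zero_mul] at this
      exact this.mono_left nhdsWithin_le_nhds
    have h2 : Tendsto (fun b : ℝ => M * D * S * b ^ (α : ℝ)) (𝓝[>] 0) (𝓝 0) := by
      have : Tendsto (fun b : ℝ => M * D * S * b ^ (α : ℝ)) (𝓝 0) (𝓝 (M * D * S * 0 ^ (α : ℝ))) :=
        (Real.continuousAt_rpow_const 0 α (Or.inr hα.le)).tendsto.const_mul _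
      rw [Real.zero_rpow hα.ne', mul_zero] at this
      exact this.mono_left nhdsWithin_le_nhds
    obtain ⟨b, h3, h4, h5⟩ := ((h1.eventually_le_const hr).and
      ((h2.eventually_le_const one_half_pos).and self_mem_nhdsWithin)).exists
    exact ⟨b, h5, h3, h4⟩
  refine ⟨η * (g 0 * b / (2 * M)), by have := hg 0; positivity, fun y hy hyC => ?_⟩
  set d : ℕ → V := fun n => Φ n y - Φ n z with hd
  have hzK : ∀ n : ℕ, Φ n z ∈ K := fun n => hinv n z hz
  have hdec : ∀ p ∈ K, ∀ v : V, ∃ e ∈ E p, ∃ f ∈ F p, e + f = v := fun p hp v =>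
    Submodule.mem_sup.1 ((hs.isCompl p hp).sup_eq_top ▸ Submodule.mem_top)
  set R : ℕ → V := fun n => d (n + 1) - flowDeriv Φ 1 (Φ n z) (d n) with hR
  choose sE hsE sF hsF hsR using fun n : ℕ => hdec _ (hzK (n + 1)) (R n)
  obtain ⟨e0, he0, f0, hf0, hef0⟩ := hdec z hz (d 0)
  -- The components of `d n` are propagated by the derivative, the remainder being split along `E`
  -- and `F` at each step.
  let e : ℕ → V := fun n => Nat.rec e0 (fun n v => flowDeriv Φ 1 (Φ n z) v + sE n) n
  let f : ℕ → V := fun n => Nat.rec f0 (fun n v => flowDeriv Φ 1 (Φ n z) v + sF n) n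
  have heS : ∀ n, e (n + 1) = flowDeriv Φ 1 (Φ n z) (e n) + sE n := fun n => rfl
  have hfS : ∀ n, f (n + 1) = flowDeriv Φ 1 (Φ n z) (f n) + sF n := fun n => rfl
  have heE : ∀ n : ℕ, e n ∈ E (Φ n z) := by
    intro n
    induction n with
    | zero => rw [Nat.cast_zero, Φ.map_zero_apply]; exact he0
    | succ n ih =>
      rw [heS]
      refine Submodule.add_mem _ ?_ (hsE n)
      rw [flow_natCast_succ]
      exact hs.deriv_mem_E (hzK n) ih zero_le_one
  have hfF : ∀ n : ℕ, f n ∈ F (Φ n z) := by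
    intro n
    induction n with
    | zero => rw [Nat.cast_zero, Φ.map_zero_apply]; exact hf0
    | succ n ih =>
      rw [hfS]
      refine Submodule.add_mem _ ?_ (hsF n)
      rw [flow_natCast_succ]
      exact hs.deriv_mem_F (hzK n) ih zero_le_one
  have hef : ∀ n, e n + f n = d n := by
    intro n
    induction n with
    | zero => exact hef0
    | succ n ih =>
      have h1 := hsR n
      simp only [hR] at h1
      rw [heS, hfS, ← add_sub_cancel (flowDeriv Φ 1 (Φ n z) (d n)) (d (n + 1)), ← h1, ← ih, map_add]
      abel
  have hdf : ∀ n, ‖d n‖ ≤ c₁ * ‖f n‖ := by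
    intro n
    -- A dominant `E`-component would put `d n` in `C`; this is the only use of not being ordered.
    have h1 : η * ‖e n‖ < ‖f n‖ := by
      by_contra! hcon
      have := hη1 _ (hzK n) _ (heE n) _ hcon
      rw [hef] at this
      exact hyC n this
    have h2 : ‖e n‖ ≤ η⁻¹ * ‖f n‖ := by
      rw [← div_eq_inv_mul, le_div_iff₀ hη]; linarith
    rw [← hef, hc₁, add_mul, one_mul]
    linarith [norm_add_le (e n) (f n)]
  have hsFR : ∀ n, ‖sF n‖ ≤ η⁻¹ * ‖R n‖ := by
    intro n
    have := (hη2 _ (hzK (n + 1)) _ (hsE n) _ (hsF n)).2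
    rw [hsR] at this
    rw [← div_eq_inv_mul, le_div_iff₀ hη]; linarith
  -- Discrete variation of constants. The free index `i` lets the induction move the derivative past
  -- each step; `i = 0` is what is needed.
  have hvar : ∀ n i : ℕ, ‖flowDeriv Φ i (Φ n z) (f n)‖ ≤
      M * g (n + i) * (‖f0‖ / g 0 + ∑ j ∈ Finset.range n, ‖sF j‖ / g (j + 1)) := by
    intro n
    induction n with
    | zero =>
      intro i
      have := hgF 0 i (f 0) (hfF 0)
      rw [Finset.sum_range_zero, add_zero]
      refine this.trans_eq ?_
      change M * (g (0 + i) / g 0) * ‖f0‖ = _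
      ring
    | succ n ih =>
      intro i
      have h1 := ih (i + 1)
      have h2 := hgF (n + 1) i (sF n) (hsF n)
      have h3 : flowDeriv Φ i (Φ ((n + 1 : ℕ) : ℝ) z) (f (n + 1)) =
          flowDeriv Φ ((i + 1 : ℕ) : ℝ) (Φ n z) (f n) +
            flowDeriv Φ i (Φ ((n + 1 : ℕ) : ℝ) z) (sF n) := by
        rw [hfS, map_add, flow_natCast_succ, ← flowDeriv_add hcd, Nat.cast_succ]
      rw [h3, Finset.sum_range_succ]
      refine (norm_add_le _ _).trans ((add_le_add h1 h2).trans_eq ?_)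
      rw [show n + (i + 1) = n + 1 + i by ring]
      ring
  have hf0' : M * (‖f0‖ / g 0) ≤ b / 2 := by
    have h1 := (hη2 z hz e0 he0 f0 hf0).2
    rw [hef0] at h1
    have h2 : d 0 = y - z := by simp only [hd, Nat.cast_zero, Φ.map_zero_apply]
    rw [h2] at h1
    have h3 : ‖f0‖ ≤ g 0 * b / (2 * M) :=
      (mul_lt_mul_iff_right₀ hη).1 (h1.trans_lt hy) |>.le
    have := hg 0
    calc M * (‖f0‖ / g 0) ≤ M * (g 0 * b / (2 * M) / g 0) := by gcongr
      _ = b / 2 := by field_simp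
  have hfb : ∀ n, ‖f n‖ ≤ b * g n := by
    intro n
    induction n using Nat.strong_induction_on with
    | _ n ih =>
      -- The remainder is of order `g j ^ (1 + α)`; dividing by `g (j + 1) ≥ c * g j` leaves the
      -- summable `g j ^ α`.
      have hterm : ∀ j ∈ Finset.range n, ‖sF j‖ / g (j + 1) ≤ D * b ^ (α : ℝ) * b * g j ^ (α : ℝ) := by
        intro j hj
        have h1 := ih j (Finset.mem_range.1 hj)
        have hgj := hg j
        have h2 : ‖d j‖ ≤ c₁ * (b * g j) := (hdf j).trans (by gcongr)
        have h3 : ‖d j‖ ≤ r := by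
          refine h2.trans (le_trans ?_ hb1)
          rw [← mul_assoc]
          have := hG' j
          gcongr
        have h4 : ‖R j‖ ≤ L * ‖d j‖ ^ (α : ℝ) * ‖d j‖ := by
          have := hrem _ (hzK j) (d j) h3
          have h5 : Φ j z + d j = Φ j y := by simp [hd]
          rw [h5, ← flow_natCast_succ, ← flow_natCast_succ] at this
          exact this
        have h5 : ‖R j‖ ≤ L * (c₁ * (b * g j)) ^ (α : ℝ) * (c₁ * (b * g j)) :=
          h4.trans (by gcongr)
        have h6 : c * g j ≤ g (j + 1) := hgc j
        calc ‖sF j‖ / g (j + 1) ≤ η⁻¹ * ‖R j‖ / (c * g j) := by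
              have := hsFR j
              gcongr
          _ ≤ η⁻¹ * (L * (c₁ * (b * g j)) ^ (α : ℝ) * (c₁ * (b * g j))) / (c * g j) := by gcongr
          _ = D * b ^ (α : ℝ) * b * g j ^ (α : ℝ) := by
            rw [Real.mul_rpow hc₁0.le (by positivity), Real.mul_rpow hb.le hgj.le, hD]
            field_simp
      have hsum' : ∑ j ∈ Finset.range n, ‖sF j‖ / g (j + 1) ≤ D * b ^ (α : ℝ) * b * S := by
        refine (Finset.sum_le_sum hterm).trans ?_
        rw [← Finset.mul_sum]
        gcongr
        exact hsum.sum_le_tsum _ fun j _ => Real.rpow_nonneg (hg j).le _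
      have h1 := hvar n 0
      rw [Nat.cast_zero, flowDeriv_zero, add_zero] at h1
      have hgn := hg n
      calc ‖f n‖ ≤ M * g n * (‖f0‖ / g 0 + D * b ^ (α : ℝ) * b * S) := h1.trans (by gcongr)
        _ = g n * (M * (‖f0‖ / g 0) + M * D * S * b ^ (α : ℝ) * b) := by ring
        _ ≤ g n * (b / 2 + 1 / 2 * b) := by gcongr
        _ = b * g n := by ring
  refine squeeze_zero_norm (a := fun n => c₁ * b * g n) (fun n => ?_) ?_
  · calc ‖d n‖ ≤ c₁ * ‖f n‖ := hdf n
      _ ≤ c₁ * (b * g n) := by have := hfb n; gcongr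
      _ = _ := by ring
  · simpa using hg0.const_mul (c₁ * b)

end Local

/-! ### Omega-limit sets and asymptotic orbits. -/

section Omega

variable {V : Type*} [NormedAddCommGroup V] {Φ : Flow ℝ V} {x z : V}

theorem mem_omegaSet_iff : z ∈ omegaSet Φ x ↔ MapClusterPt z atTop fun t => Φ t x :=
  mem_omegaLimit_singleton_iff_mapClusterPt ..

theorem flow_mem_omegaSet (hz : z ∈ omegaSet Φ x) (t : ℝ) : Φ t z ∈ omegaSet Φ x :=
  Φ.isInvariant_omegaLimit atTop {x} (fun t => tendsto_atTop_add_const_left _ t tendsto_id) t hz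

theorem isCompact_omegaSet [ProperSpace V] (hx : Bornology.IsBounded (Φ.forwardOrbit x)) :
    IsCompact (omegaSet Φ x) := by
  refine hx.isCompact_closure.of_isClosed_subset (isClosed_omegaLimit ..) fun z hz => ?_
  have h1 := mem_omegaSet_iff.1 hz
  rw [mapClusterPt_iff_frequently] at h1
  rw [mem_closure_iff_nhds]
  intro s hs
  obtain ⟨t, ht, ht0⟩ := ((h1 s hs).and_eventually (eventually_ge_atTop 0)).exists
  exact ⟨Φ t x, ht, ⟨⟨t, ht0⟩, rfl⟩⟩

theorem isEquilibrium_iff : IsEquilibrium Φ x ↔ ∀ t : ℝ, 0 ≤ t → Φ t x = x := by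
  rw [IsEquilibrium, Flow.forwardOrbit_eq_range_nonneg]
  constructor
  · intro h t ht
    have : Φ t x ∈ range fun t : {t : ℝ // 0 ≤ t} => Φ t x := ⟨⟨t, ht⟩, rfl⟩
    rwa [h] at this
  · intro h
    refine Subset.antisymm ?_ ?_
    · rintro _ ⟨t, rfl⟩
      exact h t t.2
    · rintro _ rfl
      exact ⟨⟨0, le_rfl⟩, Φ.map_zero_apply _⟩

theorem eq_of_mem_omegaSet_of_tendsto {u : V} (hz : z ∈ omegaSet Φ x) {G : V → V}
    (hG : Continuous G) (h : Tendsto (fun t => G (Φ t x)) atTop (𝓝 u)) : G z = u := by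
  by_contra hne
  obtain ⟨U, W, hU, hW, hzU, huW, hd⟩ := t2_separation hne
  have h1 := (mapClusterPt_iff_frequently.1 (mem_omegaSet_iff.1 hz)) _
    ((hU.preimage hG).mem_nhds hzU)
  obtain ⟨t, ht, ht'⟩ := (h1.and_eventually (h (hW.mem_nhds huW))).exists
  exact disjoint_left.1 hd ht ht'

theorem omegaSet_eq_singleton_of_tendsto (hz : z ∈ omegaSet Φ x) {u : V}
    (h : Tendsto (fun t => Φ t x) atTop (𝓝 u)) : omegaSet Φ x = {z} := by
  refine Subset.antisymm (fun p hp => ?_) (singleton_subset_iff.2 hz)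
  exact (eq_of_mem_omegaSet_of_tendsto hp continuous_id h).trans
    (eq_of_mem_omegaSet_of_tendsto hz continuous_id h).symm

/-- Orbits that are asymptotic along integer times to an orbit in a compact invariant set are
asymptotic to it. -/
theorem tendsto_flow_sub_of_nat {K : Set V} (hK : IsCompact K)
    (hinv : ∀ t : ℝ, ∀ y ∈ K, Φ t y ∈ K) {y : V} (hz : z ∈ K)
    (h : Tendsto (fun n : ℕ => Φ n y - Φ n z) atTop (𝓝 0)) :
    Tendsto (fun t : ℝ => Φ t y - Φ t z) atTop (𝓝 0) := by
  rw [Metric.tendsto_nhds]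
  intro ε hε
  -- Uniform continuity of the flow at points of `[0, 1] × K` bridges the gaps between integer
  -- times; the other point need not lie in `K`.
  have huc := ((isCompact_Icc (a := (0 : ℝ)) (b := 1)).prod hK).uniformContinuousAt_of_continuousAt
    (fun p : ℝ × V => Φ p.1 p.2) (fun p _ => Φ.cont'.continuousAt) (Metric.dist_mem_uniformity hε)
  obtain ⟨δ, hδ, hsub⟩ := Metric.mem_uniformity_dist.1 huc
  have h1 := (tendsto_nat_floor_atTop (α := ℝ)).eventually ((Metric.tendsto_nhds.1 h) δ hδ)
  filter_upwards [h1, eventually_ge_atTop 0] with t ht ht0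
  have hs0 : 0 ≤ t - ⌊t⌋₊ := sub_nonneg.2 (Nat.floor_le ht0)
  have hs1 : t - ⌊t⌋₊ ≤ 1 := by linarith [Nat.lt_floor_add_one t]
  have key : ∀ p, Φ t p = Φ (t - ⌊t⌋₊) (Φ ⌊t⌋₊ p) := fun p => by
    rw [← Φ.map_add, sub_add_cancel]
  have h2 := hsub (a := (t - ⌊t⌋₊, Φ ⌊t⌋₊ z)) (b := (t - ⌊t⌋₊, Φ ⌊t⌋₊ y)) (by
    rw [Prod.dist_eq, dist_self, max_eq_right dist_nonneg, dist_comm, dist_eq_norm]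
    simpa using ht) ⟨⟨hs0, hs1⟩, hinv _ z hz⟩
  rw [key y, key z, dist_zero_right, ← dist_eq_norm, dist_comm]
  exact h2

theorem isEquilibrium_of_small_times {h₀ : ℝ} (h0 : 0 < h₀)
    (h : ∀ s, 0 ≤ s → s < h₀ → Φ s z = z) : IsEquilibrium Φ z := by
  refine isEquilibrium_iff.2 fun t ht => ?_
  obtain ⟨n, hn⟩ := exists_nat_gt (t / h₀)
  have hn0 : (0 : ℝ) < n := lt_of_le_of_lt (by positivity) hn
  have hs : Φ (t / n) z = z := h _ (by positivity) (by
    rw [div_lt_iff₀ hn0]; rw [div_lt_iff₀ h0] at hn; linarith)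
  have hm : ∀ m : ℕ, Φ (m * (t / n)) z = z := by
    intro m
    induction m with
    | zero => rw [Nat.cast_zero, zero_mul, Φ.map_zero_apply]
    | succ m ih => rw [Nat.cast_succ, add_mul, one_mul, Φ.map_add, hs, ih]
  have := hm n
  rwa [mul_div_cancel₀ _ hn0.ne'] at this

end Omega

/-! ### Proof of the alternative. -/

section Main

variable {V : Type*} [NormedAddCommGroup V] [NormedSpace ℝ V] {k : ℕ}
  {C : Set V} {Φ : Flow ℝ V} {x z : V}

/-- If the orbit of `x` is not pseudo-ordered, then it never becomes ordered with the orbit of one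
of its omega-limit points. -/
theorem FWW.not_ordered_of_mem_omegaSet (hΦ : FWW k C Φ) (hxQ : x ∉ pseudoOrderedSet C Φ)
    (hxe : ¬ IsEquilibrium Φ x) (hz : z ∈ omegaSet Φ x) {τ t : ℝ} (hτ : 0 ≤ τ) (ht : 0 ≤ t)
    (hne : Φ τ x ≠ z) : Φ t (Φ τ x) - Φ t z ∉ C := by
  intro hC
  have hQ : ∀ t₁ t₂ : ℝ, 0 ≤ t₁ → 0 ≤ t₂ → Φ t₁ x - Φ t₂ x ∈ C → Φ t₁ x = Φ t₂ x := by
    intro t₁ t₂ h₁ h₂ h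
    by_contra hne
    exact hxQ ⟨hxe, t₁, t₂, h₁, h₂, hne, h⟩
  have hinj : ∀ s : ℝ, Function.Injective (Φ s) := fun s =>
    Function.LeftInverse.injective (g := Φ (-s)) (flow_neg_flow Φ s)
  -- Strong monotonicity makes the order relation open, so `z` can be replaced by some nearby `Φ s x
  -- ≠ Φ τ x`, producing two distinct ordered points on the orbit of `x`.
  have h1 : Φ 1 (Φ t (Φ τ x)) - Φ 1 (Φ t z) ∈ interior C :=
    hΦ.stronglyMonotone.2 _ _ ((hinj t).ne hne) hC 1 one_pos
  have hopen : IsOpen {p | Φ 1 (Φ t (Φ τ x)) - Φ 1 (Φ t p) ∈ interior C} :=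
    isOpen_interior.preimage (continuous_const.sub
      ((Φ.continuous_toFun 1).comp (Φ.continuous_toFun t)))
  have hnhds := Filter.inter_mem (hopen.mem_nhds h1) (isOpen_ne.mem_nhds hne.symm)
  obtain ⟨s, ⟨hs, hsne⟩, hs0⟩ := ((mapClusterPt_iff_frequently.1 (mem_omegaSet_iff.1 hz) _
    hnhds).and_eventually (eventually_ge_atTop 0)).exists
  have hs' : Φ 1 (Φ t (Φ τ x)) - Φ 1 (Φ t (Φ s x)) ∈ C := interior_subset hs
  simp only [← Φ.map_add] at hs'
  have h2 := hQ _ _ (by positivity) (by positivity) hs'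
  simp only [Φ.map_add] at h2
  exact hsne (hinj t (hinj 1 h2)).symm

theorem FWW.omegaSet_eq_of_nonpos [FiniteDimensional ℝ V] (hΦ : FWW k C Φ)
    (hx : Bornology.IsBounded (Φ.forwardOrbit x)) {E F : V → Submodule ℝ V}
    (hs : IsExpSeparation k C Φ (omegaSet Φ x) E F) (hz : z ∈ omegaSet Φ x)
    (hlyap : lyapunovExponent Φ E z ≤ 0) (hxQ : x ∉ pseudoOrderedSet C Φ) :
    omegaSet Φ x = {z} ∧ IsEquilibrium Φ z := by
  -- Equilibria lie outside `Q` by definition and need a separate treatment.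
  by_cases hxe : IsEquilibrium Φ x
  · have hlim : Tendsto (fun t => Φ t x) atTop (𝓝 x) :=
      tendsto_const_nhds.congr' ((eventually_ge_atTop 0).mono fun t ht =>
        (isEquilibrium_iff.1 hxe t ht).symm)
    have hzx : z = x := eq_of_mem_omegaSet_of_tendsto hz continuous_id hlim
    exact ⟨omegaSet_eq_singleton_of_tendsto hz hlim, hzx ▸ hxe⟩
  have hproper : ProperSpace V := FiniteDimensional.proper_real V
  have hK := isCompact_omegaSet hx
  have hinv : ∀ t : ℝ, ∀ y ∈ omegaSet Φ x, Φ t y ∈ omegaSet Φ x := fun t y hy =>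
    flow_mem_omegaSet hy t
  obtain ⟨r, hr, hloc⟩ := hs.exists_local_alternative hΦ hK hinv hz hlyap
  have hasymp : ∀ τ : ℝ, 0 ≤ τ → ‖Φ τ x - z‖ < r →
      Tendsto (fun t => Φ t (Φ τ x) - Φ t z) atTop (𝓝 0) := by
    intro τ hτ hτr
    by_cases hne : Φ τ x = z
    · simp [hne]
    · exact tendsto_flow_sub_of_nat hK hinv hz (hloc _ hτr fun n =>
        hΦ.not_ordered_of_mem_omegaSet hxQ hxe hz hτ n.cast_nonneg hne)
  obtain ⟨τ, hτr, hτ⟩ := ((mapClusterPt_iff_frequently.1 (mem_omegaSet_iff.1 hz) _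
    (Metric.ball_mem_nhds z hr)).and_eventually (eventually_ge_atTop 0)).exists
  obtain ⟨h₀, h0, hball⟩ := Metric.mem_nhds_iff.1
    ((Metric.isOpen_ball.preimage (Φ.continuous continuous_id continuous_const)).mem_nhds hτr)
  have hshift : ∀ {G : ℝ → V} {u : V}, Tendsto (fun t => G (t + τ)) atTop (𝓝 u) →
      Tendsto G atTop (𝓝 u) := fun {G u} h => by
    have := h.comp (tendsto_atTop_add_const_right _ (-τ) tendsto_id)
    simpa [Function.comp_def] using this
  have hfix : ∀ s, 0 ≤ s → s < h₀ → Φ s z = z := by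
    intro s hs0 hs1
    have hball' : τ + s ∈ Metric.ball τ h₀ := by
      simpa [Real.dist_eq, abs_of_nonneg hs0] using hs1
    have h1 := hasymp (τ + s) (by positivity) (by
      have := hball hball'
      rwa [mem_preimage, Metric.mem_ball, dist_eq_norm] at this)
    have h2 := hasymp τ hτ (by rwa [← dist_eq_norm])
    -- Both `Φ (t + τ + s) x` and `Φ (t + τ) x` are asymptotic to the same `Φ t z`, so their
    -- difference vanishes; at the limit point `z` this reads `Φ s z = z`.
    have h3 : Tendsto (fun t => Φ s (Φ t x) - Φ t x) atTop (𝓝 0) := by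
      refine hshift ?_
      have h4 := h1.sub h2
      rw [sub_zero] at h4
      refine h4.congr fun t => ?_
      simp only [← Φ.map_add]
      rw [sub_sub_sub_cancel_right, show t + (τ + s) = s + (t + τ) by ring]
    have := eq_of_mem_omegaSet_of_tendsto hz (G := fun p => Φ s p - p)
      ((Φ.continuous_toFun s).sub continuous_id) h3
    exact sub_eq_zero.1 this
  have hze := isEquilibrium_of_small_times h0 hfix
  refine ⟨omegaSet_eq_singleton_of_tendsto hz (u := z) (hshift ?_), hze⟩
  have h2 := (hasymp τ hτ (by rwa [← dist_eq_norm])).add_const z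
  rw [zero_add] at h2
  refine h2.congr' ((eventually_ge_atTop 0).mono fun t ht => ?_)
  rw [isEquilibrium_iff.1 hze t ht, sub_add_cancel]
  exact (Φ.map_add t τ x).symm

end Main

end KCone

theorem theorem4p2 {V : Type*} [NormedAddCommGroup V] [NormedSpace ℝ V] [FiniteDimensional ℝ V]
    (k : ℕ) (C : Set V) (Φ : Flow ℝ V) (hΦ : KCone.FWW k C Φ)
    (x : V) (hx : Bornology.IsBounded (Φ.forwardOrbit x)) :
    (∃ E F : V → Submodule ℝ V, KCone.IsExpSeparation k C Φ (KCone.omegaSet Φ x) E F) ∧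
    ∀ E F : V → Submodule ℝ V, KCone.IsExpSeparation k C Φ (KCone.omegaSet Φ x) E F →
      ∀ z ∈ KCone.omegaSet Φ x, KCone.IsRegularPoint Φ E z → KCone.lyapunovExponent Φ E z ≤ 0 →
        x ∈ KCone.pseudoOrderedSet C Φ ∨
          (KCone.omegaSet Φ x = {z} ∧ KCone.IsEquilibrium Φ z) := by
  have hproper : ProperSpace V := FiniteDimensional.proper_real V
  refine ⟨hΦ.exists_isExpSeparation (KCone.isCompact_omegaSet hx) fun t y hy =>
    KCone.flow_mem_omegaSet hy t, fun E F hs z hz _ hlyap => ?_⟩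
  exact or_iff_not_imp_left.2 fun hxQ => hΦ.omegaSet_eq_of_nonpos hx hs hz hlyap hxQ
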